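/- **Theorem 3.1 (uniform stability of the discrete inverse problem).** For $N\in\mathbb N$ put $h=1/(N+1)$. For grid functions $v=(v_j)_{0\le j\le N+1}$ write $(\partial_h^+v)_j=\frac{v_{j+1}-v_j}{h}$ for $0\le j\le N$, $(\partial_h^-v)_j=\frac{v_j-v_{j-1}}{h}$ for $1\le j\le N+1$, and $(\Delta_hv)_j=\frac{v_{j+1}-2v_j+v_{j-1}}{h^2}$ for $1\le j\le N$. Set $$\|f\|_{L^2_h(0,1)}^2=h\sum_{j=1}^N|f_j|^2,\qquad \|f\|_{L^2_h([0,1))}^2=h\sum_{j=0}^N|f_j|^2,\qquad \|f\|_{L^\infty_h(0,1)}=\max_{1\le j\le N}|f_j|,$$ and $\|y\|^2_{H^1(0,T;L^\infty_h(0,1))}=\int_0^T\big(\|y(t)\|^2_{L^\infty_h(0,1)}+\|\partial_ty(t)\|^2_{L^\infty_h(0,1)}\big)\,dt$. Let $L^\infty_{h,\le m}(0,1)$ be the set of real $q=(q_j)_{1\le j\le N}$ with $\|q\|_{L^\infty_h(0,1)}\le m$. Given real data $g_j\in L^1(0,T)$ $(1\le j\le N)$, $g^0,g^1\in L^2(0,T)$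 and $y^0,y^1\in\mathbb R^N$, let $y_h[q]$ denote the solution of $$\begin{cases}\partial_{tt}y_j-(\Delta_hy)_j+q_jy_j=g_j, & t\in(0,T),\ 1\le j\le N,\\ y_0(t)=g^0(t),\quad y_{N+1}(t)=g^1(t), & t\in[0,T],\\ y_j(0)=y^0_j,\quad \partial_ty_j(0)=y^1_j, & 1\le j\le N,\end{cases}$$ where, for $1\le j\le N$, $y_j$ is differentiable on $[0,T]$ with absolutely continuous derivative and the equation holds for almost every $t$. Let $T>1$, $m>0$, $K>0$, $r>0$. There is a constant $C=C(T,m,K,r)>0$, independent of $N$ (that is, of $h$) and of the data, such that the following holds for all $N$ and all data as above. If $p_h\in L^\infty_{h,\le m}(0,1)$ satisfies $\|y_h[p_h]\|_{H^1(0,T;L^\infty_h(0,1))}\le K$, and if $|y^0_j|\ge r$ for all $1\le j\le N$, then for every $q_h\in L^\infty_{h,\le m}(0,1)$ the components of $y_h[q_h]-y_h[p_h]$, with indices $0\le j\le N+1$, are twice continuously differentiable on $[0,T]$, and $$\|q_h-p_h\|_{L^2_h(0,1)}\le C\,\big\|\partial_t\big(\partial_h^-(y_h[q_h]-y_h[p_h])\big)_{N+1}\big\|_{L^2(0,T)}+C\,\big\|h\,\partial_h^+\partial_{tt}(y_h[q_h]-y_h[p_h])\big\|_{L^2(0,T;L^2_h([0,1)))}.$$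 -/

import Mathlib

open MeasureTheory Set

noncomputable section

namespace SemiDiscreteWave

/-! Grid functions on the points `x_j = j h` with `h = 1 / (N + 1)` and `0 ≤ j ≤ N + 1` are written
as functions of `j : ℕ`; only the indices in the indicated ranges are ever used. -/

/-- The mesh size `h = 1 / (N + 1)`. -/
def meshSize (N : ℕ) : ℝ := 1 / ((N : ℝ) + 1)

/-- `(∂_h^+ v)_j = (v_{j+1} - v_j) / h`. -/
def forwardDiff (N : ℕ) (v : ℕ → ℝ) (j : ℕ) : ℝ := (v (j + 1) - v j) / meshSize N

/-- `(∂_h^- v)_j = (v_j - v_{j-1}) / h`, used for `1 ≤ j` only. -/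
def backwardDiff (N : ℕ) (v : ℕ → ℝ) (j : ℕ) : ℝ := (v j - v (j - 1)) / meshSize N

/-- `(Δ_h v)_j = (v_{j+1} - 2 v_j + v_{j-1}) / h ^ 2`, used for `1 ≤ j` only. -/
def discreteLaplacian (N : ℕ) (v : ℕ → ℝ) (j : ℕ) : ℝ :=
  (v (j + 1) - 2 * v j + v (j - 1)) / meshSize N ^ 2

/-- The norm of `L²_h(0,1)`: indices `1 ≤ j ≤ N`. -/
def l2Norm (N : ℕ) (f : ℕ → ℝ) : ℝ :=
  Real.sqrt (meshSize N * ∑ j ∈ Finset.Icc 1 N, |f j| ^ 2)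

/-- The norm of `L²_h([0,1))`: indices `0 ≤ j ≤ N`. -/
def l2NormLeft (N : ℕ) (f : ℕ → ℝ) : ℝ :=
  Real.sqrt (meshSize N * ∑ j ∈ Finset.Icc 0 N, |f j| ^ 2)

/-- The norm of `L^∞_h(0,1)`: the maximum of `|f_j|` over `1 ≤ j ≤ N` (zero if `N = 0`). -/
def linftyNorm (N : ℕ) (f : ℕ → ℝ) : ℝ := ⨆ j : {j : ℕ // j ∈ Finset.Icc 1 N}, |f j|

/-- The norm of `L²(0,T)`. -/
def timeL2Norm (T : ℝ) (F : ℝ → ℝ) : ℝ := Real.sqrt (∫ t in (0 : ℝ)..T, |F t| ^ 2)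

/-- The norm of `H¹(0,T; L^∞_h(0,1))`; it is applied to functions `y` for which `y j`,
`1 ≤ j ≤ N`, is continuously differentiable on `[0,T]`. -/
def h1LinftyNorm (N : ℕ) (T : ℝ) (y : ℕ → ℝ → ℝ) : ℝ :=
  Real.sqrt (∫ t in (0 : ℝ)..T,
    (linftyNorm N (fun j => y j t) ^ 2 + linftyNorm N (fun j => deriv (y j) t) ^ 2))

/-- `y` solves the semi-discrete wave equation on `[0,T]` with potential `q`, source `g`, boundary
values `g0`, `g1` and initial data `y0`, `y1`. The source is only integrable in time, so each
interior component is differentiable on `[0,T]` with an absolutely continuous derivative, and the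
equation holds for almost every `t` in `(0,T)`. -/
structure IsSolution (N : ℕ) (T : ℝ) (q : ℕ → ℝ) (g : ℕ → ℝ → ℝ) (g0 g1 : ℝ → ℝ)
    (y0 y1 : ℕ → ℝ) (y : ℕ → ℝ → ℝ) : Prop where
  boundary_left : ∀ t ∈ Icc 0 T, y 0 t = g0 t
  boundary_right : ∀ t ∈ Icc 0 T, y (N + 1) t = g1 t
  initial_position : ∀ j ∈ Finset.Icc 1 N, y j 0 = y0 j
  initial_velocity : ∀ j ∈ Finset.Icc 1 N, derivWithin (y j) (Icc 0 T) 0 = y1 j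
  differentiable : ∀ j ∈ Finset.Icc 1 N, DifferentiableOn ℝ (y j) (Icc 0 T)
  absolutelyContinuous : ∀ j ∈ Finset.Icc 1 N,
    AbsolutelyContinuousOnInterval (derivWithin (y j) (Icc 0 T)) 0 T
  equation : ∀ j ∈ Finset.Icc 1 N, ∀ᵐ t ∂(volume.restrict (Ioo 0 T)),
    deriv (derivWithin (y j) (Icc 0 T)) t - discreteLaplacian N (fun i => y i t) j + q j * y j t
      = g j t

end SemiDiscreteWave

end

open SemiDiscreteWave

namespace SemiDiscreteWave

open Finset Filter Topology

/-! Let z be the difference of the two solutions. The external source cancels, and w = ∂ₜz solves a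
linear wave equation with zero boundary values, zero initial position, source f · ∂ₜy[p] and initial
velocity f · y⁰, where f = p − q. Since |y⁰| ≥ r, the initial kinetic energy of w dominates r²‖f‖²,
so it suffices to bound that energy by the observations plus a small multiple of itself.

Fine grids. Take a weight e close to exp(μx), and let E, P, W be the weighted energy, momentum and
mass of w. Up to boundary terms, sources and discretization errors, E' = −μP and P' = −μE. With γ =
(1 − c)μ, the functional Q = E − 2P − W then satisfies γQ − Q' ≤ observations + O(1/μ) · source
(`carleman_rate_le`). Integrating in time, Q(0) is the initial weighted kinetic energy, while the
final time enters with the factor exp(−γT) max e, which is exponentially small in μ because T > 1. A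
Gronwall bound (`IsLinearizedWave.energy_final_le`) brings the final energy back to time 0, and a
large μ absorbs everything but the observations (`le_of_absorption`). The discretization errors are
squares of jumps v_{j+1} − v_j of v = ∂ₜₜz; they are the reason for the second observation term.

Coarse grids. Once μ is fixed, a grid that is too coarse for the weight has h bounded below. A
discrete Poincaré inequality then lets the jumps alone control the kinetic energy, through kinetic
energy minus potential energy minus mass (`coarse_rate_le`). The two regimes together give a
constant independent of N. -/

/-! ### Summation by parts and the weighted energy and momentum identities. -/

theorem sum_range_mul_sub (N : ℕ) (X d : ℕ → ℝ) :
    ∑ j ∈ range N, X (j + 1) * (d (j + 1) - d j) =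
      ∑ j ∈ range (N + 1), d j * (X j - X (j + 1)) + X (N + 1) * d N - X 0 * d 0 := by
  induction N with
  | zero => simp; ring
  | succ n ih => rw [sum_range_succ, ih, sum_range_succ _ (n + 1)]; ring

theorem sum_range_add_succ (N : ℕ) (X : ℕ → ℝ) :
    ∑ j ∈ range (N + 1), (X j + X (j + 1)) =
      2 * ∑ j ∈ range N, X (j + 1) + X 0 + X (N + 1) := by
  induction N with
  | zero => simp
  | succ n ih => rw [sum_range_succ, ih, sum_range_succ _ n]; ring

noncomputable section

/-- Weighted energy of a nodal velocity `v` and an edge slope `d`. -/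
def weightedEnergy (N : ℕ) (h : ℝ) (e v d : ℕ → ℝ) : ℝ :=
  h / 2 * (∑ j ∈ range N, e (j + 1) * v (j + 1) ^ 2 +
    ∑ j ∈ range (N + 1), (e j + e (j + 1)) / 2 * d j ^ 2)

/-- Weighted momentum, the discrete version of `∫ e v d`. -/
def weightedMomentum (N : ℕ) (h : ℝ) (e v d : ℕ → ℝ) : ℝ :=
  h / 2 * ∑ j ∈ range (N + 1), d j * (e j * v j + e (j + 1) * v (j + 1))

/-- Weighted `L²` energy of a nodal function. -/
def weightedMass (N : ℕ) (h : ℝ) (e w : ℕ → ℝ) : ℝ :=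
  h / 2 * ∑ j ∈ range N, e (j + 1) * w (j + 1) ^ 2

theorem weightedMass_nonneg {N : ℕ} {h : ℝ} {e : ℕ → ℝ} (hh : 0 ≤ h) (he : ∀ j, 0 ≤ e j)
    (w : ℕ → ℝ) : 0 ≤ weightedMass N h e w :=
  mul_nonneg (by positivity) (sum_nonneg fun j _ => mul_nonneg (he _) (sq_nonneg _))

theorem edgeEnergy_nonneg {N : ℕ} {h : ℝ} {e : ℕ → ℝ} (hh : 0 ≤ h) (he : ∀ j, 0 ≤ e j)
    (d : ℕ → ℝ) : 0 ≤ h / 2 * ∑ j ∈ range (N + 1), (e j + e (j + 1)) / 2 * d j ^ 2 :=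
  mul_nonneg (by positivity) (sum_nonneg fun j _ =>
    mul_nonneg (by linarith [he j, he (j + 1)]) (sq_nonneg _))

theorem weightedEnergy_eq (N : ℕ) (h : ℝ) (e v d : ℕ → ℝ) :
    weightedEnergy N h e v d = weightedMass N h e v +
      h / 2 * ∑ j ∈ range (N + 1), (e j + e (j + 1)) / 2 * d j ^ 2 := by
  simp only [weightedEnergy, weightedMass]; ring

theorem weightedMass_le_weightedEnergy {N : ℕ} {h : ℝ} {e : ℕ → ℝ} (hh : 0 ≤ h)
    (he : ∀ j, 0 ≤ e j) (v d : ℕ → ℝ) : weightedMass N h e v ≤ weightedEnergy N h e v d := by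
  rw [weightedEnergy_eq]
  linarith [edgeEnergy_nonneg (N := N) hh he d]

theorem weightedEnergy_eq_edges {N : ℕ} (h : ℝ) (e d : ℕ → ℝ) {v : ℕ → ℝ} (v0 : v 0 = 0)
    (vN : v (N + 1) = 0) :
    weightedEnergy N h e v d = h / 2 * ∑ j ∈ range (N + 1),
      ((e j * v j ^ 2 + e (j + 1) * v (j + 1) ^ 2) / 2 + (e j + e (j + 1)) / 2 * d j ^ 2) := by
  rw [weightedEnergy, sum_add_distrib, ← sum_div,
    sum_range_add_succ N fun j => e j * v j ^ 2]
  simp [v0, vN]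

/-- Arithmetic–geometric mean inequality edge by edge; vanishing boundary velocities allow the nodal
kinetic energy to be distributed over the edges. -/
theorem abs_weightedMomentum_le {N : ℕ} {h : ℝ} {e v : ℕ → ℝ} (hh : 0 ≤ h) (he : ∀ j, 0 ≤ e j)
    (d : ℕ → ℝ) (v0 : v 0 = 0) (vN : v (N + 1) = 0) :
    |weightedMomentum N h e v d| ≤ weightedEnergy N h e v d := by
  rw [weightedEnergy_eq_edges h e d v0 vN, weightedMomentum, abs_mul, abs_of_nonneg (by positivity)]
  refine mul_le_mul_of_nonneg_left ((abs_sum_le_sum_abs _ _).trans (sum_le_sum fun j _ => ?_))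
    (by positivity)
  rw [abs_le]
  constructor
  · nlinarith [mul_nonneg (he j) (sq_nonneg (d j + v j)),
      mul_nonneg (he (j + 1)) (sq_nonneg (d j + v (j + 1)))]
  · nlinarith [mul_nonneg (he j) (sq_nonneg (d j - v j)),
      mul_nonneg (he (j + 1)) (sq_nonneg (d j - v (j + 1)))]

/-- Rate of change of the weighted energy along the semi-discrete wave equation. -/
theorem weightedEnergy_rate {N : ℕ} {h : ℝ} (hh : 0 < h) {e v d G a : ℕ → ℝ} (v0 : v 0 = 0)
    (vN : v (N + 1) = 0) (ha : ∀ j ∈ range N, a (j + 1) = (d (j + 1) - d j) / h + G (j + 1)) :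
    h * ∑ j ∈ range N, e (j + 1) * (v (j + 1) * a (j + 1)) +
        ∑ j ∈ range (N + 1), (e j + e (j + 1)) / 2 * (d j * (v (j + 1) - v j)) =
      -(1 / 2) * ∑ j ∈ range (N + 1), (e (j + 1) - e j) * (d j * (v j + v (j + 1))) +
        h * ∑ j ∈ range N, e (j + 1) * (v (j + 1) * G (j + 1)) := by
  have h1 : h * ∑ j ∈ range N, e (j + 1) * (v (j + 1) * a (j + 1)) =
      ∑ j ∈ range N, (e (j + 1) * v (j + 1)) * (d (j + 1) - d j) +
        h * ∑ j ∈ range N, e (j + 1) * (v (j + 1) * G (j + 1)) := by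
    rw [mul_sum, mul_sum, ← sum_add_distrib]
    refine sum_congr rfl fun j hj => ?_
    rw [ha j hj]; field_simp
  rw [h1, sum_range_mul_sub N (fun j => e j * v j) d, v0, vN]
  rw [show ∀ A B C D : ℝ, A + e (N + 1) * 0 * B - e 0 * 0 * C + D = A + D by intros; ring,
    add_right_comm, ← sum_add_distrib, mul_sum (range (N + 1)) _ (-(1 / 2) : ℝ)]
  congr 1
  exact sum_congr rfl fun j _ => by ring

/-- Rate of change of the weighted momentum along the semi-discrete wave equation. -/
theorem weightedMomentum_rate {N : ℕ} {h : ℝ} (hh : 0 < h) {e v d G a : ℕ → ℝ} (v0 : v 0 = 0)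
    (vN : v (N + 1) = 0) (a0 : a 0 = 0) (aN : a (N + 1) = 0)
    (ha : ∀ j ∈ range N, a (j + 1) = (d (j + 1) - d j) / h + G (j + 1)) :
    1 / 2 * ∑ j ∈ range (N + 1), (v (j + 1) - v j) * (e j * v j + e (j + 1) * v (j + 1)) +
        h / 2 * ∑ j ∈ range (N + 1), d j * (e j * a j + e (j + 1) * a (j + 1)) =
      -(1 / 2) * ∑ j ∈ range (N + 1), (e (j + 1) - e j) * (d j ^ 2 + v j * v (j + 1)) +
        1 / 2 * (e (N + 1) * d N ^ 2 - e 0 * d 0 ^ 2) +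
        h / 2 * ∑ j ∈ range N, e (j + 1) * (G (j + 1) * (d (j + 1) + d j)) := by
  -- Telescoping e_j v_j² leaves the neighbour products v_j v_{j+1} where the continuous identity
  -- has v²; this is one origin of the jump terms.
  have h1 : ∑ j ∈ range (N + 1), (v (j + 1) - v j) * (e j * v j + e (j + 1) * v (j + 1)) =
      -∑ j ∈ range (N + 1), (e (j + 1) - e j) * (v j * v (j + 1)) := by
    have := sum_range_sub (fun j => e j * v j ^ 2) (N + 1)
    simp only [v0, vN] at this
    rw [← sum_neg_distrib, ← sub_eq_zero, ← sum_sub_distrib]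
    rw [← sub_eq_zero] at this
    rw [← show _ = (0 : ℝ) from this.trans (by ring)]
    ring_nf
    exact sum_congr rfl fun j _ => by ring
  have h2 : ∑ j ∈ range (N + 1), d j * (e j * a j + e (j + 1) * a (j + 1)) =
      ∑ j ∈ range N, (e (j + 1) * a (j + 1)) * (d (j + 1) + d j) := by
    have : ∀ M, ∑ j ∈ range (M + 1), d j * (e j * a j + e (j + 1) * a (j + 1)) =
        ∑ j ∈ range M, (e (j + 1) * a (j + 1)) * (d (j + 1) + d j) + d 0 * (e 0 * a 0) +
          d M * (e (M + 1) * a (M + 1)) := by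
      intro M
      induction M with
      | zero => simp; ring
      | succ n ih => rw [sum_range_succ, ih, sum_range_succ _ n]; ring
    rw [this, a0, aN]; ring
  -- The centred multiplier d_{j+1} + d_j turns the second difference into the exact difference
  -- d_{j+1}² − d_j², so the slopes produce no discretization error.
  have h3 : h * ∑ j ∈ range N, (e (j + 1) * a (j + 1)) * (d (j + 1) + d j) =
      ∑ j ∈ range N, e (j + 1) * (d (j + 1) ^ 2 - d j ^ 2) +
        h * ∑ j ∈ range N, e (j + 1) * (G (j + 1) * (d (j + 1) + d j)) := by
    rw [mul_sum, mul_sum, ← sum_add_distrib]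
    refine sum_congr rfl fun j hj => ?_
    rw [ha j hj]; field_simp; ring
  rw [sum_range_mul_sub N e fun j => d j ^ 2] at h3
  have h4 : ∑ j ∈ range (N + 1), (e (j + 1) - e j) * (d j ^ 2 + v j * v (j + 1)) =
      ∑ j ∈ range (N + 1), (e (j + 1) - e j) * (v j * v (j + 1)) -
        ∑ j ∈ range (N + 1), d j ^ 2 * (e j - e (j + 1)) := by
    rw [← sum_sub_distrib]
    exact sum_congr rfl fun j _ => by ring
  rw [h1, h2, h4]
  linarith

/-! ### The pointwise-in-time Carleman inequality on fine grids. -/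

/-- Regrouped by nodes, the coefficient of v_j² is (e_{j−1} + 2e_j + e_{j+1})/2, which convexity
bounds below by 2e_j. -/
theorem sum_edge_mean_sq_ge {N : ℕ} {e v : ℕ → ℝ} (hc : ∀ j, 2 * e (j + 1) ≤ e j + e (j + 2))
    (v0 : v 0 = 0) (vN : v (N + 1) = 0) :
    2 * ∑ j ∈ range N, e (j + 1) * v (j + 1) ^ 2 ≤
      ∑ j ∈ range (N + 1), (e j + e (j + 1)) / 2 * (v j ^ 2 + v (j + 1) ^ 2) := by
  have : ∀ M, ∑ j ∈ range (M + 1), (e j + e (j + 1)) / 2 * (v j ^ 2 + v (j + 1) ^ 2) =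
      ∑ j ∈ range M, (e j + 2 * e (j + 1) + e (j + 2)) / 2 * v (j + 1) ^ 2 +
        (e 0 + e 1) / 2 * v 0 ^ 2 + (e M + e (M + 1)) / 2 * v (M + 1) ^ 2 := by
    intro M
    induction M with
    | zero => simp; ring
    | succ n ih => rw [sum_range_succ, ih, sum_range_succ _ n]; ring
  rw [this, v0, vN, mul_sum]
  have := sum_le_sum (s := range N) fun j _ =>
    mul_le_mul_of_nonneg_right (hc j) (sq_nonneg (v (j + 1)))
  have h2 : ∑ j ∈ range N, (e j + 2 * e (j + 1) + e (j + 2)) / 2 * v (j + 1) ^ 2 =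
      ∑ j ∈ range N, ((e j + e (j + 2)) * v (j + 1) ^ 2 + 2 * e (j + 1) * v (j + 1) ^ 2) / 2 :=
    sum_congr rfl fun j _ => by ring
  rw [h2, ← sum_div, sum_add_distrib]
  have h3 : ∑ j ∈ range N, 2 * (e (j + 1) * v (j + 1) ^ 2) =
      ∑ j ∈ range N, 2 * e (j + 1) * v (j + 1) ^ 2 := sum_congr rfl fun j _ => by ring
  rw [h3]
  linarith

/-- `h ∑ ẽ (v_{j+1} - v_j)²` with `ẽ` the edge average of `e`. -/
def weightedJump (N : ℕ) (h : ℝ) (e v : ℕ → ℝ) : ℝ :=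
  h * ∑ j ∈ range (N + 1), (e j + e (j + 1)) / 2 * (v (j + 1) - v j) ^ 2

theorem weightedJump_nonneg {N : ℕ} {h : ℝ} {e : ℕ → ℝ} (hh : 0 ≤ h) (he : ∀ j, 0 ≤ e j)
    (v : ℕ → ℝ) : 0 ≤ weightedJump N h e v :=
  mul_nonneg hh (sum_nonneg fun j _ => mul_nonneg (by linarith [he j, he (j + 1)]) (sq_nonneg _))

theorem mul_le_add_sq_div {c : ℝ} (hc : 0 < c) (x y : ℝ) : x * y ≤ c * x ^ 2 + y ^ 2 / (4 * c) := by
  have : c * x ^ 2 + y ^ 2 / (4 * c) - x * y = (2 * c * x - y) ^ 2 / (4 * c) := by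
    field_simp; ring
  have h2 : 0 ≤ (2 * c * x - y) ^ 2 / (4 * c) := by positivity
  linarith

/-- Exponential grid weights: positive, convex, and geometric with rate `μ`. -/
structure IsExpWeight (h μ : ℝ) (e : ℕ → ℝ) : Prop where
  pos : ∀ j, 0 < e j
  rate : ∀ j, e (j + 1) - e j = μ * h * ((e j + e (j + 1)) / 2)
  convex : ∀ j, 2 * e (j + 1) ≤ e j + e (j + 2)

theorem energy_cross_le {N : ℕ} {h μ c : ℝ} {e : ℕ → ℝ} (hh : 0 < h) (hμ : 0 < μ) (hc : 0 < c)
    (hμh : μ * h ≤ 2) (he : IsExpWeight h μ e) (v d : ℕ → ℝ) :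
    1 / 2 * ∑ j ∈ range (N + 1), (e (j + 1) - e j) * (d j * (v j + v (j + 1))) ≤
      μ * weightedMomentum N h e v d + μ * c * weightedEnergy N h e v d +
        μ / (8 * c) * weightedJump N h e v := by
  have hE := weightedMass_nonneg (N := N) hh.le (fun j => (he.pos j).le) v
  have key : 1 / 2 * ∑ j ∈ range (N + 1), (e (j + 1) - e j) * (d j * (v j + v (j + 1))) ≤
      μ * weightedMomentum N h e v d + μ * c *
      (h / 2 * ∑ j ∈ range (N + 1), (e j + e (j + 1)) / 2 * d j ^ 2) +
        μ / (8 * c) * weightedJump N h e v := by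
    simp only [weightedMomentum, weightedJump, mul_sum, ← sum_add_distrib]
    refine sum_le_sum fun j _ => ?_
    have hm : 0 < (e j + e (j + 1)) / 2 := by linarith [he.pos j, he.pos (j + 1)]
    set b := (e j + e (j + 1)) / 2 with hb
    have hr : e (j + 1) - e j = μ * h * b := he.rate j
    have h1 : e j = b - μ * h * b / 2 := by linarith
    have h2 : e (j + 1) = b + μ * h * b / 2 := by linarith
    rw [h1, h2]
    -- Replacing nodal weights by their edge mean b leaves a product of slope and jump with factor
    -- μh/2 ≤ 1, which Young's inequality splits.
    have h3 : -(μ * h / 2) * (d j * (v (j + 1) - v j)) ≤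
        c * d j ^ 2 + (v (j + 1) - v j) ^ 2 / (4 * c) := by
      have h4 := mul_le_add_sq_div hc (d j) (v (j + 1) - v j)
      have h5 := mul_le_add_sq_div hc (-d j) (v (j + 1) - v j)
      have h6 : 0 ≤ μ * h / 2 := by positivity
      have h7 : 0 ≤ c * d j ^ 2 + (v (j + 1) - v j) ^ 2 / (4 * c) := by positivity
      calc -(μ * h / 2) * (d j * (v (j + 1) - v j))
          = (μ * h / 2) * (-d j * (v (j + 1) - v j)) := by ring
        _ ≤ (μ * h / 2) * (c * d j ^ 2 + (v (j + 1) - v j) ^ 2 / (4 * c)) :=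
            mul_le_mul_of_nonneg_left (by simpa using h5) h6
        _ ≤ 1 * (c * d j ^ 2 + (v (j + 1) - v j) ^ 2 / (4 * c)) :=
            mul_le_mul_of_nonneg_right (by linarith) h7
        _ = _ := one_mul _
    have h8 := mul_le_mul_of_nonneg_left h3 (show 0 ≤ μ * (h / 2) * b by positivity)
    have h9 : μ / (8 * c) * (h * (b * (v (j + 1) - v j) ^ 2)) =
        μ * (h / 2) * b * ((v (j + 1) - v j) ^ 2 / (4 * c)) := by field_simp; ring
    rw [h9]
    linarith
  have : 0 ≤ μ * c * weightedMass N h e v := by positivity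
  rw [weightedEnergy_eq]
  linarith

/-- Rests on v_j v_{j+1} = (v_j² + v_{j+1}²)/2 − (v_{j+1} − v_j)²/2: convexity of the weight handles
the squares, and the rest is the jump term. -/
theorem momentum_cross_le {N : ℕ} {h μ : ℝ} {e v : ℕ → ℝ} (hh : 0 < h) (hμ : 0 < μ)
    (he : IsExpWeight h μ e) (d : ℕ → ℝ) (v0 : v 0 = 0) (vN : v (N + 1) = 0) :
    -(1 / 2) * ∑ j ∈ range (N + 1), (e (j + 1) - e j) * (d j ^ 2 + v j * v (j + 1)) ≤
      -μ * weightedEnergy N h e v d + μ / 4 * weightedJump N h e v := by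
  have h1 := sum_edge_mean_sq_ge he.convex v0 vN
  have h2 : -(1 / 2) * ∑ j ∈ range (N + 1), (e (j + 1) - e j) * (d j ^ 2 + v j * v (j + 1)) =
      -μ * (h / 2 * ∑ j ∈ range (N + 1), (e j + e (j + 1)) / 2 * d j ^ 2) -
        μ * h / 4 * ∑ j ∈ range (N + 1), (e j + e (j + 1)) / 2 * (v j ^ 2 + v (j + 1) ^ 2) +
        μ / 4 * weightedJump N h e v := by
    simp only [weightedJump, mul_sum, ← sum_add_distrib, ← sum_sub_distrib]
    refine sum_congr rfl fun j _ => ?_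
    rw [he.rate j]; ring
  rw [h2, weightedEnergy]
  have := mul_le_mul_of_nonneg_left h1 (show 0 ≤ μ * h / 4 by positivity)
  linarith

/-- The combination d_{j+1} + d_j − v_{j+1} is what multiplies the source in the derivative of 2P −
E. -/
theorem sum_weighted_slope_le {N : ℕ} {h : ℝ} {e : ℕ → ℝ} (hh : 0 < h) (he : ∀ j, 0 ≤ e j)
    (v d : ℕ → ℝ) :
    h * ∑ j ∈ range N, e (j + 1) * (d (j + 1) + d j - v (j + 1)) ^ 2 ≤
      12 * weightedEnergy N h e v d := by
  have h1 : ∑ j ∈ range N, e (j + 1) * (d (j + 1) ^ 2 + d j ^ 2) ≤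
      ∑ j ∈ range (N + 1), (e j + e (j + 1)) * d j ^ 2 := by
    have : ∀ M, ∑ j ∈ range (M + 1), (e j + e (j + 1)) * d j ^ 2 =
        ∑ j ∈ range M, e (j + 1) * (d (j + 1) ^ 2 + d j ^ 2) + e 0 * d 0 ^ 2 +
          e (M + 1) * d M ^ 2 := by
      intro M
      induction M with
      | zero => simp; ring
      | succ n ih => rw [sum_range_succ, ih, sum_range_succ _ n]; ring
    rw [this]
    have := mul_nonneg (he 0) (sq_nonneg (d 0))
    have := mul_nonneg (he (N + 1)) (sq_nonneg (d N))
    linarith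
  have h2 : ∑ j ∈ range N, e (j + 1) * (d (j + 1) + d j - v (j + 1)) ^ 2 ≤
      3 * ∑ j ∈ range N, e (j + 1) * (d (j + 1) ^ 2 + d j ^ 2) +
        3 * ∑ j ∈ range N, e (j + 1) * v (j + 1) ^ 2 := by
    rw [mul_sum, mul_sum, ← sum_add_distrib]
    refine sum_le_sum fun j _ => ?_
    have : (d (j + 1) + d j - v (j + 1)) ^ 2 ≤
        3 * (d (j + 1) ^ 2 + d j ^ 2) + 3 * v (j + 1) ^ 2 := by
      nlinarith [sq_nonneg (d (j + 1) - d j), sq_nonneg (d (j + 1) + v (j + 1)),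
        sq_nonneg (d j + v (j + 1))]
    calc _ ≤ e (j + 1) * (3 * (d (j + 1) ^ 2 + d j ^ 2) + 3 * v (j + 1) ^ 2) :=
          mul_le_mul_of_nonneg_left this (he _)
      _ = _ := by ring
  have h3 : ∑ j ∈ range (N + 1), (e j + e (j + 1)) * d j ^ 2 =
      2 * ∑ j ∈ range (N + 1), (e j + e (j + 1)) / 2 * d j ^ 2 := by
    rw [mul_sum]; exact sum_congr rfl fun j _ => by ring
  have h4 : 0 ≤ ∑ j ∈ range N, e (j + 1) * v (j + 1) ^ 2 :=
    sum_nonneg fun j _ => mul_nonneg (he _) (sq_nonneg _)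
  rw [weightedEnergy]
  have := mul_le_mul_of_nonneg_left (show ∑ j ∈ range N,
    e (j + 1) * (d (j + 1) + d j - v (j + 1)) ^ 2 ≤ 6 * (∑ j ∈ range N, e (j + 1) * v (j + 1) ^ 2 +
    ∑ j ∈ range (N + 1), (e j + e (j + 1)) / 2 * d j ^ 2) by linarith) hh.le
  linarith

theorem sum_weighted_source_sq_le {N : ℕ} {h m κ : ℝ} {e w q f Y G : ℕ → ℝ} (hh : 0 < h)
    (he : ∀ j, 0 ≤ e j) (hq : ∀ j ∈ range N, |q (j + 1)| ≤ m)
    (hY : ∀ j ∈ range N, Y (j + 1) ^ 2 ≤ κ)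
    (hG : ∀ j ∈ range N, G (j + 1) = f (j + 1) * Y (j + 1) - q (j + 1) * w (j + 1)) :
    h * ∑ j ∈ range N, e (j + 1) * G (j + 1) ^ 2 ≤
      4 * m ^ 2 * weightedMass N h e w + 4 * κ * weightedMass N h e f := by
  simp only [weightedMass, mul_sum, ← sum_add_distrib]
  refine sum_le_sum fun j hj => ?_
  have h1 : q (j + 1) ^ 2 ≤ m ^ 2 := sq_le_sq' (by linarith [neg_abs_le (q (j + 1)), hq j hj])
    ((le_abs_self _).trans (hq j hj))
  have h2 : G (j + 1) ^ 2 ≤ 2 * (m ^ 2 * w (j + 1) ^ 2) + 2 * (κ * f (j + 1) ^ 2) := by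
    rw [hG j hj]
    nlinarith [mul_le_mul_of_nonneg_right h1 (sq_nonneg (w (j + 1))),
      mul_le_mul_of_nonneg_right (hY j hj) (sq_nonneg (f (j + 1))),
      sq_nonneg (f (j + 1) * Y (j + 1) + q (j + 1) * w (j + 1))]
  have := mul_le_mul_of_nonneg_left h2 (mul_nonneg hh.le (he (j + 1)))
  linarith

theorem sum_weighted_mul_le {N : ℕ} {h k : ℝ} {e : ℕ → ℝ} (hh : 0 < h) (hk : 0 < k)
    (he : ∀ j, 0 ≤ e j) (x y : ℕ → ℝ) :
    h * ∑ j ∈ range N, e (j + 1) * (x (j + 1) * y (j + 1)) ≤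
      k * (h * ∑ j ∈ range N, e (j + 1) * x (j + 1) ^ 2) +
        1 / (4 * k) * (h * ∑ j ∈ range N, e (j + 1) * y (j + 1) ^ 2) := by
  simp only [mul_sum, ← sum_add_distrib]
  refine sum_le_sum fun j _ => ?_
  have := mul_le_mul_of_nonneg_left (mul_le_add_sq_div hk (x (j + 1)) (y (j + 1)))
    (mul_nonneg hh.le (he (j + 1)))
  calc _ = h * e (j + 1) * (x (j + 1) * y (j + 1)) := by ring
    _ ≤ _ := this
    _ = _ := by ring

/-- In Q = (E − P) − P − W, the part E − P nearly satisfies (E − P)' = μ(E − P), so it tolerates any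
rate below μ; the extra −P supplies a negative multiple of E to absorb errors, and −W supplies one
of W to absorb the potential. -/
theorem carleman_rate_le {N : ℕ} {h μ c m κ : ℝ} {e v d w a q f Y : ℕ → ℝ} (hh : 0 < h)
    (hμ : 0 < μ) (hc : 0 < c) (hc' : c ≤ 1 / 2) (hμh : μ * h ≤ 2) (hμc : 4 ≤ c * μ ^ 2)
    (hμm : 48 * m ^ 2 ≤ c * μ ^ 2) (he : IsExpWeight h μ e)
    (v0 : v 0 = 0) (vN : v (N + 1) = 0) (a0 : a 0 = 0) (aN : a (N + 1) = 0)
    (ha : ∀ j ∈ range N, a (j + 1) =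
      (d (j + 1) - d j) / h + (f (j + 1) * Y (j + 1) - q (j + 1) * w (j + 1)))
    (hq : ∀ j ∈ range N, |q (j + 1)| ≤ m) (hY : ∀ j ∈ range N, Y (j + 1) ^ 2 ≤ κ) :
    (1 - c) * μ * (weightedEnergy N h e v d - 2 * weightedMomentum N h e v d -
        weightedMass N h e w) -
      (h * ∑ j ∈ range N, e (j + 1) * (v (j + 1) * a (j + 1)) +
        ∑ j ∈ range (N + 1), (e j + e (j + 1)) / 2 * (d j * (v (j + 1) - v j))) +
      2 * (1 / 2 * ∑ j ∈ range (N + 1), (v (j + 1) - v j) * (e j * v j + e (j + 1) * v (j + 1)) +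
        h / 2 * ∑ j ∈ range (N + 1), d j * (e j * a j + e (j + 1) * a (j + 1))) +
      h * ∑ j ∈ range N, e (j + 1) * (w (j + 1) * v (j + 1)) ≤
    e (N + 1) * d N ^ 2 + μ * (1 / 2 + 1 / (8 * c)) * weightedJump N h e v +
      12 / (c * μ) * κ * weightedMass N h e f := by
  have he0 : ∀ j, 0 ≤ e j := fun j => (he.pos j).le
  set G : ℕ → ℝ := fun j => f j * Y j - q j * w j with hG
  rw [weightedEnergy_rate hh (G := G) v0 vN ha, weightedMomentum_rate hh (G := G) v0 vN a0 aN ha]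
  have h1 := energy_cross_le (N := N) hh hμ hc hμh he v d
  have h2 := momentum_cross_le hh hμ he d v0 vN
  -- The Young parameter cμ/12 offsets the constant 12 of `sum_weighted_slope_le`, so the source
  -- costs cμE. The discretization error and the derivative of W cost cμE each as well.
  have hk : 0 < c * μ / 12 := by positivity
  have h3 := sum_weighted_mul_le (N := N) hh hk he0
    (fun j => d j + d (j - 1) - v j) G
  simp only [Nat.add_sub_cancel] at h3
  have h4 := sum_weighted_slope_le (N := N) hh he0 v d
  have h5 := sum_weighted_source_sq_le (G := G) hh he0 hq hY (fun j _ => rfl)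
  have hγ : 0 < (1 - c) * μ := mul_pos (by linarith) hμ
  have h6 := sum_weighted_mul_le (N := N) hh (show 0 < (1 - c) * μ / 4 by positivity) he0 w v
  have h7 := abs_le.1 (abs_weightedMomentum_le hh.le he0 d v0 vN)
  have h8 : h * ∑ j ∈ range N, e (j + 1) * ((d (j + 1) + d j - v (j + 1)) * G (j + 1)) =
      h * ∑ j ∈ range N, e (j + 1) * (G (j + 1) * (d (j + 1) + d j)) -
      h * ∑ j ∈ range N, e (j + 1) * (v (j + 1) * G (j + 1)) := by
    rw [← mul_sub, ← sum_sub_distrib]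
    congr 1
    exact sum_congr rfl fun j _ => by ring
  have hW : h * ∑ j ∈ range N, e (j + 1) * w (j + 1) ^ 2 = 2 * weightedMass N h e w := by
    rw [weightedMass]; ring
  have hV : h * ∑ j ∈ range N, e (j + 1) * v (j + 1) ^ 2 = 2 * weightedMass N h e v := by
    rw [weightedMass]; ring
  have hVE := weightedMass_le_weightedEnergy (N := N) hh.le he0 v d
  have hV0 := weightedMass_nonneg (N := N) hh.le he0 v
  have hW0 := weightedMass_nonneg (N := N) hh.le he0 w
  rw [h8] at h3
  rw [hW, hV] at h6
  set E := weightedEnergy N h e v d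
  set P := weightedMomentum N h e v d
  set W := weightedMass N h e w
  set V := weightedMass N h e v
  set J := weightedJump N h e v
  set F := weightedMass N h e f
  have hE0 : 0 ≤ E := hV0.trans hVE
  have h9 := mul_le_mul_of_nonneg_left h4 hk.le
  have h10 := mul_le_mul_of_nonneg_left h5 (show 0 ≤ 1 / (4 * (c * μ / 12)) by positivity)
  have e1 : 1 / (4 * (c * μ / 12)) * (4 * m ^ 2 * W + 4 * κ * F) =
      12 * m ^ 2 / (c * μ) * W + 12 / (c * μ) * κ * F := by field_simp
  rw [e1] at h10
  have e2 : 1 / (4 * ((1 - c) * μ / 4)) ≤ c * μ / 2 := by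
    rw [div_le_iff₀ (by positivity)]
    nlinarith [mul_le_mul_of_nonneg_right hc' (show 0 ≤ c * μ ^ 2 by positivity)]
  have e3 : 12 * m ^ 2 / (c * μ) ≤ (1 - c) * μ / 2 := by
    rw [div_le_iff₀ (by positivity)]
    nlinarith [mul_le_mul_of_nonneg_right hc' (show 0 ≤ c * μ ^ 2 by positivity)]
  have h11 := mul_le_mul_of_nonneg_right e3 hW0
  have h12 := mul_le_mul e2 hVE hV0 (by positivity)
  -- After the three losses of cμE, what remains of E and P is −(1 − 2c)μ(E + P), nonpositive
  -- because |P| ≤ E and c ≤ 1/2.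
  have h13 : (1 - 2 * c) * μ * -P ≤ (1 - 2 * c) * μ * E :=
    mul_le_mul_of_nonneg_left (by linarith [h7.1]) (mul_nonneg (by linarith) hμ.le)
  have h14 : 0 ≤ e 0 * d 0 ^ 2 := mul_nonneg (he0 0) (sq_nonneg _)
  have e4 : μ * (1 / 2 + 1 / (8 * c)) * J = 2 * (μ / 4 * J) + μ / (8 * c) * J := by ring
  rw [e4]
  linarith

end

/-! ### Unweighted estimates: energy growth, and the inequality for coarse grids. -/

theorem weightedEnergy_growth_le {N : ℕ} {h m κ : ℝ} {v d w a q f Y : ℕ → ℝ} (hh : 0 < h)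
    (hm : 0 < m) (v0 : v 0 = 0) (vN : v (N + 1) = 0)
    (ha : ∀ j ∈ range N, a (j + 1) =
      (d (j + 1) - d j) / h + (f (j + 1) * Y (j + 1) - q (j + 1) * w (j + 1)))
    (hq : ∀ j ∈ range N, |q (j + 1)| ≤ m) (hY : ∀ j ∈ range N, Y (j + 1) ^ 2 ≤ κ) :
    (h * ∑ j ∈ range N, 1 * (v (j + 1) * a (j + 1)) +
        ∑ j ∈ range (N + 1), ((1 : ℝ) + 1) / 2 * (d j * (v (j + 1) - v j))) +
      h * ∑ j ∈ range N, 1 * (w (j + 1) * v (j + 1)) ≤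
    (m + 2) * (weightedEnergy N h (fun _ => 1) v d + weightedMass N h (fun _ => 1) w) +
      κ * weightedMass N h (fun _ => 1) f := by
  rw [weightedEnergy_rate (e := fun _ => 1) hh (G := fun j => f j * Y j - q j * w j) v0 vN ha]
  have hVE := weightedMass_le_weightedEnergy (N := N) hh.le (fun _ => zero_le_one) v d
  have hW0 := weightedMass_nonneg (N := N) (e := fun _ => 1) hh.le (fun _ => zero_le_one) w
  have h1 : h * ∑ j ∈ range N, 1 * (v (j + 1) * (f (j + 1) * Y (j + 1) - q (j + 1) * w (j + 1))) +
      h * ∑ j ∈ range N, 1 * (w (j + 1) * v (j + 1)) ≤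
      (m + 2) * weightedMass N h (fun _ => 1) v + (m + 1) * weightedMass N h (fun _ => 1) w +
      κ * weightedMass N h (fun _ => 1) f := by
    simp only [weightedMass, mul_sum, ← sum_add_distrib]
    refine sum_le_sum fun j hj => ?_
    have h2 : v (j + 1) * (f (j + 1) * Y (j + 1) - q (j + 1) * w (j + 1)) + w (j + 1) * v (j + 1) ≤
        (m + 2) / 2 * v (j + 1) ^ 2 + (m + 1) / 2 * w (j + 1) ^ 2 + κ / 2 * f (j + 1) ^ 2 := by
      have h3 := mul_le_mul_of_nonneg_right (hY j hj) (sq_nonneg (f (j + 1)))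
      have h4 : -(q (j + 1) * (v (j + 1) * w (j + 1))) ≤ m * |v (j + 1) * w (j + 1)| := by
        refine (neg_le_abs _).trans ?_
        rw [abs_mul]
        exact mul_le_mul_of_nonneg_right (hq j hj) (abs_nonneg _)
      have h5 : |v (j + 1) * w (j + 1)| ≤ (v (j + 1) ^ 2 + w (j + 1) ^ 2) / 2 := by
        rw [abs_le]; constructor <;> nlinarith [sq_nonneg (v (j + 1) + w (j + 1)),
          sq_nonneg (v (j + 1) - w (j + 1))]
      have h6 := mul_le_mul_of_nonneg_left h5 hm.le
      nlinarith [sq_nonneg (v (j + 1) - f (j + 1) * Y (j + 1)),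
        sq_nonneg (v (j + 1) - w (j + 1))]
    have := mul_le_mul_of_nonneg_left h2 hh.le
    linarith
  simp only [sub_self, zero_mul, sum_const_zero, mul_zero, zero_add]
  nlinarith

/-- Discrete Poincaré inequality: v_j is the sum of at most N + 1 jumps from the left boundary, and
Cauchy–Schwarz applies. The loss of h⁻² is harmless on coarse grids only. -/
theorem weightedMass_le_jump {N : ℕ} {h : ℝ} (hN : h * (N + 1) = 1) {v : ℕ → ℝ}
    (v0 : v 0 = 0) :
    weightedMass N h (fun _ => 1) v ≤ weightedJump N h (fun _ => 1) v / h ^ 2 := by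
  have hh : 0 < h := by
    have : (0 : ℝ) < N + 1 := by positivity
    by_contra hc
    nlinarith
  set S := ∑ j ∈ range (N + 1), (v (j + 1) - v j) ^ 2 with hS
  have hS0 : 0 ≤ S := sum_nonneg fun j _ => sq_nonneg _
  have h1 : ∀ j ∈ range N, 1 * v (j + 1) ^ 2 ≤ (N + 1) * S := by
    intro j hj
    have h2 : v (j + 1) = ∑ i ∈ range (j + 1), (v (i + 1) - v i) := by
      rw [sum_range_sub, v0, sub_zero]
    have hj' : j + 1 ≤ N + 1 := by have := mem_range.1 hj; omega
    have h3 := sq_sum_le_card_mul_sum_sq (s := range (j + 1)) (f := fun i => v (i + 1) - v i)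
    rw [← h2, card_range] at h3
    have h4 : ∑ i ∈ range (j + 1), (v (i + 1) - v i) ^ 2 ≤ S :=
      sum_le_sum_of_subset_of_nonneg (range_mono hj') fun _ _ _ => sq_nonneg _
    rw [one_mul]
    refine h3.trans (mul_le_mul (by exact_mod_cast hj') h4
      (sum_nonneg fun j _ => sq_nonneg _) (by positivity))
  have h5 := sum_le_sum h1
  rw [sum_const, card_range, nsmul_eq_mul] at h5
  have h6 : weightedJump N h (fun _ => 1) v = h * S := by
    simp [weightedJump, hS]
  rw [h6, le_div_iff₀ (by positivity), weightedMass]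
  have h7 : (N : ℝ) * ((N + 1) * S) ≤ (N + 1) ^ 2 * S := by nlinarith
  calc _ ≤ h / 2 * ((N + 1) ^ 2 * S) * h ^ 2 := by
        gcongr
        exact h5.trans h7
    _ = (h * (N + 1)) ^ 2 * (h * S) / 2 := by ring
    _ ≤ h * S := by rw [hN]; nlinarith [mul_nonneg hh.le hS0]

/-- The functional is kinetic minus potential energy minus mass. Its rate −γ damps the potential
energy and the mass, while all kinetic contributions are paid for by the jumps through
`weightedMass_le_jump`. -/
theorem coarse_rate_le {N : ℕ} {h γ m κ : ℝ} {v d w a q f Y : ℕ → ℝ} (hN : h * (N + 1) = 1)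
    (hγ : 0 < γ) (hγm : 2 * m ^ 2 ≤ γ ^ 2) (v0 : v 0 = 0) (vN : v (N + 1) = 0)
    (ha : ∀ j ∈ range N, a (j + 1) =
      (d (j + 1) - d j) / h + (f (j + 1) * Y (j + 1) - q (j + 1) * w (j + 1)))
    (hq : ∀ j ∈ range N, |q (j + 1)| ≤ m) (hY : ∀ j ∈ range N, Y (j + 1) ^ 2 ≤ κ) :
    γ * (2 * weightedMass N h (fun _ => 1) v - weightedEnergy N h (fun _ => 1) v d -
        weightedMass N h (fun _ => 1) w) -
      2 * (h * ∑ j ∈ range N, 1 * (v (j + 1) * a (j + 1))) +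
      (h * ∑ j ∈ range N, 1 * (v (j + 1) * a (j + 1)) +
        ∑ j ∈ range (N + 1), ((1 : ℝ) + 1) / 2 * (d j * (v (j + 1) - v j))) +
      h * ∑ j ∈ range N, 1 * (w (j + 1) * v (j + 1)) ≤
    (3 * γ + 4 / γ) / h ^ 2 * weightedJump N h (fun _ => 1) v +
      κ / γ * weightedMass N h (fun _ => 1) f := by
  have hh : 0 < h := by
    have : (0 : ℝ) < N + 1 := by positivity
    by_contra hc
    nlinarith
  have he0 : ∀ j : ℕ, (0 : ℝ) ≤ (fun _ : ℕ => (1 : ℝ)) j := fun _ => zero_le_one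
  set G : ℕ → ℝ := fun j => f j * Y j - q j * w j with hG
  have hrate := weightedEnergy_rate (e := fun _ => 1) hh (G := G) v0 vN ha
  simp only [sub_self, zero_mul, sum_const_zero, mul_zero, zero_add] at hrate
  have h3 := sum_weighted_mul_le (N := N) hh hγ he0 (fun j => -v j) G
  have h5 := sum_weighted_source_sq_le (G := G) hh he0 hq hY (fun j _ => rfl)
  have h6 := sum_weighted_mul_le (N := N) hh (show 0 < γ / 4 by positivity) he0 w v
  have h7 := weightedMass_le_jump hN v0
  have hW0 := weightedMass_nonneg (N := N) hh.le he0 w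
  have hV0 := weightedMass_nonneg (N := N) hh.le he0 v
  -- The sign flip of the potential energy prevents the usual cancellation in the energy identity;
  -- the surplus is split between the damped potential energy and the jumps.
  have h8 : 2 * ∑ j ∈ range (N + 1), ((1 : ℝ) + 1) / 2 * (d j * (v (j + 1) - v j)) ≤
      γ * (h / 2 * ∑ j ∈ range (N + 1), ((1 : ℝ) + 1) / 2 * d j ^ 2) +
        2 / γ / h ^ 2 * weightedJump N h (fun _ => 1) v := by
    simp only [weightedJump, mul_sum, ← sum_add_distrib]
    refine sum_le_sum fun j _ => ?_
    have := mul_le_add_sq_div (show 0 < γ / 2 * h by positivity) (d j) (2 * (v (j + 1) - v j))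
    have e : (2 * (v (j + 1) - v j)) ^ 2 / (4 * (γ / 2 * h)) =
      2 / γ / h ^ 2 * (h * ((1 + 1) / 2 * (v (j + 1) - v j) ^ 2)) := by field_simp; ring
    rw [e] at this
    linarith
  rw [weightedEnergy_eq]
  have hW : h * ∑ j ∈ range N, 1 * w (j + 1) ^ 2 = 2 * weightedMass N h (fun _ => 1) w := by
    rw [weightedMass]; ring
  have hV : h * ∑ j ∈ range N, 1 * v (j + 1) ^ 2 = 2 * weightedMass N h (fun _ => 1) v := by
    rw [weightedMass]; ring
  rw [hW, hV] at h6
  simp only [neg_sq] at h3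
  rw [hV] at h3
  have e1 : h * ∑ j ∈ range N, 1 * (-v (j + 1) * G (j + 1)) =
      -(h * ∑ j ∈ range N, 1 * (v (j + 1) * G (j + 1))) := by
    rw [← mul_neg, ← sum_neg_distrib]
    congr 1
    exact sum_congr rfl fun j _ => by ring
  rw [e1] at h3
  set W := weightedMass N h (fun _ => 1) w
  set V := weightedMass N h (fun _ => 1) v
  set J := weightedJump N h (fun _ => 1) v
  set F := weightedMass N h (fun _ => 1) f
  set D := h / 2 * ∑ j ∈ range (N + 1), ((1 : ℝ) + 1) / 2 * d j ^ 2
  have h10 := mul_le_mul_of_nonneg_left h5 (show 0 ≤ 1 / (4 * γ) by positivity)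
  have e2 : 1 / (4 * γ) * (4 * m ^ 2 * W + 4 * κ * F) = m ^ 2 / γ * W + κ / γ * F := by
    field_simp
  rw [e2] at h10
  have e3 : m ^ 2 / γ ≤ γ / 2 := by rw [div_le_iff₀ hγ]; nlinarith
  have h11 := mul_le_mul_of_nonneg_right e3 hW0
  have e4 : 1 / (4 * (γ / 4)) * (2 * V) = 2 / γ * V := by field_simp
  rw [e4] at h6
  have h12 := mul_le_mul_of_nonneg_left h7 (show 0 ≤ 3 * γ + 2 / γ by positivity)
  have e5 : (3 * γ + 4 / γ) / h ^ 2 * J = (3 * γ + 2 / γ) * (J / h ^ 2) + 2 / γ / h ^ 2 * J := by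
    field_simp; ring
  rw [e5]
  linarith

/-! ### Geometric weights, uniformly bounded in N. -/

/-- The geometric weight `((1 + σ h) / (1 - σ h)) ^ j`. -/
noncomputable def geomWeight (h σ : ℝ) (j : ℕ) : ℝ := ((1 + σ * h) / (1 - σ * h)) ^ j

/-- The ratio is the trapezoidal discretization of e' = 2σe, so the rate identity is exact.
Convexity is e_j(ρ − 1)² ≥ 0 for the ratio ρ. -/
theorem geomWeight_isExpWeight {h σ : ℝ} (hh : 0 < h) (hσ : 0 < σ) (hσh : σ * h < 1) :
    IsExpWeight h (2 * σ) (geomWeight h σ) := by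
  have h1 : 0 < 1 - σ * h := by linarith
  have h2 : 0 < (1 + σ * h) / (1 - σ * h) := by positivity
  refine ⟨fun j => pow_pos h2 j, fun j => ?_, fun j => ?_⟩
  · simp only [geomWeight]
    rw [pow_succ]
    field_simp
    ring
  · simp only [geomWeight]
    have := mul_nonneg (pow_pos h2 j).le (sq_nonneg ((1 + σ * h) / (1 - σ * h) - 1))
    rw [pow_succ, pow_add]
    linarith

theorem one_le_geomWeight {h σ : ℝ} (hh : 0 < h) (hσ : 0 < σ) (hσh : σ * h < 1) (j : ℕ) :
    1 ≤ geomWeight h σ j := by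
  refine one_le_pow₀ ?_
  rw [le_div_iff₀ (by linarith)]
  nlinarith [mul_pos hσ hh]

theorem geomWeight_le {h σ : ℝ} {N : ℕ} (hN : h * (N + 1) = 1) (hh : 0 < h) (hσ : 0 < σ)
    (hσh : σ * h < 1) {j : ℕ} (hj : j ≤ N + 1) :
    geomWeight h σ j ≤ Real.exp (2 * σ / (1 - σ * h)) := by
  have h1 : 0 < 1 - σ * h := by linarith
  have h2 : (1 + σ * h) / (1 - σ * h) ≤ Real.exp (2 * σ * h / (1 - σ * h)) := by
    have : (1 + σ * h) / (1 - σ * h) = 2 * σ * h / (1 - σ * h) + 1 := by field_simp; ring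
    rw [this]
    exact Real.add_one_le_exp _
  have h3 : 1 ≤ (1 + σ * h) / (1 - σ * h) := by
    simpa [geomWeight] using one_le_geomWeight hh hσ hσh 1
  calc geomWeight h σ j ≤ geomWeight h σ (N + 1) := pow_le_pow_right₀ h3 hj
    _ ≤ Real.exp (2 * σ * h / (1 - σ * h)) ^ (N + 1) := pow_le_pow_left₀ (by positivity) h2 _
    _ = Real.exp (2 * σ / (1 - σ * h)) := by
      rw [← Real.exp_nat_mul]
      congr 1
      push_cast
      calc ((N : ℝ) + 1) * (2 * σ * h / (1 - σ * h)) = (h * (N + 1)) * (2 * σ) / (1 - σ * h) := by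
            ring
        _ = _ := by rw [hN, one_mul]

/-! ### The linearized equation and integration of the inequalities in time. -/

/-- The linearized semi-discrete wave equation `∂ₜₜw = Δ_h w - q w + f Y` with homogeneous boundary
conditions, zero initial position and initial velocity `f y⁰`; `v = ∂ₜw`, `a = ∂ₜₜw`. -/
structure IsLinearizedWave (N : ℕ) (T m : ℝ) (q f y0 : ℕ → ℝ) (κ : ℝ → ℝ)
    (Y w v a : ℕ → ℝ → ℝ) : Prop where
  continuousOn_w : ∀ j ≤ N + 1, ContinuousOn (w j) (Icc 0 T)
  continuousOn_v : ∀ j ≤ N + 1, ContinuousOn (v j) (Icc 0 T)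
  hasDerivAt_w : ∀ j ≤ N + 1, ∀ t ∈ Ioo 0 T, HasDerivAt (w j) (v j t) t
  hasDerivAt_v : ∀ j ≤ N + 1, ∀ t ∈ Ioo 0 T, HasDerivAt (v j) (a j t) t
  v_left : ∀ t ∈ Icc 0 T, v 0 t = 0
  v_right : ∀ t ∈ Icc 0 T, v (N + 1) t = 0
  a_left : ∀ t ∈ Ioo 0 T, a 0 t = 0
  a_right : ∀ t ∈ Ioo 0 T, a (N + 1) t = 0
  equation : ∀ t ∈ Ioo 0 T, ∀ j ∈ range N, a (j + 1) t =
    (forwardDiff N (fun i => w i t) (j + 1) - forwardDiff N (fun i => w i t) j) / meshSize N +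
      (f (j + 1) * Y (j + 1) t - q (j + 1) * w (j + 1) t)
  abs_q_le : ∀ j ∈ range N, |q (j + 1)| ≤ m
  continuousOn_κ : ContinuousOn κ (Icc 0 T)
  κ_nonneg : ∀ t ∈ Icc 0 T, 0 ≤ κ t
  sq_Y_le : ∀ t ∈ Ioo 0 T, ∀ j ∈ range N, Y (j + 1) t ^ 2 ≤ κ t
  w_zero : ∀ j ≤ N + 1, w j 0 = 0
  v_zero : ∀ j ∈ range N, v (j + 1) 0 = f (j + 1) * y0 (j + 1)

theorem meshSize_pos (N : ℕ) : 0 < meshSize N := by unfold meshSize; positivity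

theorem meshSize_mul (N : ℕ) : meshSize N * (N + 1) = 1 := by unfold meshSize; field_simp

/-- The derivative of exp(−γt) Q is at least −φ, since exp(−γt) ≤ 1 and φ ≥ 0. -/
theorem le_exp_mul_add_integral {T : ℝ} {Q Q' φ : ℝ → ℝ} {γ : ℝ} (hT : 0 ≤ T) (hγ : 0 ≤ γ)
    (hc : ContinuousOn Q (Icc 0 T)) (hd : ∀ t ∈ Ioo 0 T, HasDerivAt Q (Q' t) t)
    (hφ : ContinuousOn φ (Icc 0 T)) (hφ0 : ∀ t ∈ Ioo 0 T, 0 ≤ φ t)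
    (hle : ∀ t ∈ Ioo 0 T, γ * Q t - Q' t ≤ φ t) :
    Q 0 ≤ Real.exp (-(γ * T)) * Q T + ∫ t in (0 : ℝ)..T, φ t := by
  have h1 := intervalIntegral.sub_le_integral_of_hasDeriv_right_of_le (a := 0) (b := T) hT
    (g := fun t => -(Real.exp (-(γ * t)) * Q t))
    (g' := fun t => Real.exp (-(γ * t)) * (γ * Q t - Q' t)) (φ := φ) ?_ ?_ hφ.integrableOn_Icc ?_
  · simp only [mul_zero, neg_zero, Real.exp_zero, one_mul] at h1
    linarith
  · exact (ContinuousOn.mul (by fun_prop) hc).neg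
  · intro t ht
    have h2 : HasDerivAt (fun t => Real.exp (-(γ * t))) (Real.exp (-(γ * t)) * -γ) t := by
      simpa using (((hasDerivAt_id t).const_mul γ).neg).exp
    exact (((h2.mul (hd t ht)).neg).congr_deriv (by ring)).hasDerivWithinAt
  · intro t ht
    have h3 : Real.exp (-(γ * t)) ≤ 1 := by
      rw [Real.exp_le_one_iff]
      have := mul_nonneg hγ ht.1.le
      linarith
    calc _ ≤ Real.exp (-(γ * t)) * φ t := mul_le_mul_of_nonneg_left (hle t ht) (Real.exp_pos _).le
      _ ≤ 1 * φ t := mul_le_mul_of_nonneg_right h3 (hφ0 t ht)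
      _ = _ := one_mul _

theorem weightedMass_mono {N : ℕ} {h : ℝ} {e e' : ℕ → ℝ} (hh : 0 ≤ h) (he : ∀ j ≤ N + 1, e j ≤ e' j)
    (x : ℕ → ℝ) : weightedMass N h e x ≤ weightedMass N h e' x :=
  mul_le_mul_of_nonneg_left (sum_le_sum fun j hj => mul_le_mul_of_nonneg_right
    (he _ (by have := mem_range.1 hj; omega)) (sq_nonneg _)) (by positivity)

theorem weightedMass_const (N : ℕ) (h M : ℝ) (x : ℕ → ℝ) :
    weightedMass N h (fun _ => M) x = M * weightedMass N h (fun _ => 1) x := by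
  simp only [weightedMass, one_mul, ← mul_sum]; ring

theorem weightedEnergy_le_const {N : ℕ} {h M : ℝ} {e : ℕ → ℝ} (hh : 0 ≤ h) (he : ∀ j ≤ N + 1, e j ≤ M)
    (x d : ℕ → ℝ) : weightedEnergy N h e x d ≤ M * weightedEnergy N h (fun _ => 1) x d := by
  have : weightedEnergy N h e x d ≤ weightedEnergy N h (fun _ => M) x d := by
    refine mul_le_mul_of_nonneg_left (add_le_add (sum_le_sum fun j hj => ?_)
      (sum_le_sum fun j hj => ?_)) (by positivity)
    · exact mul_le_mul_of_nonneg_right (he _ (by have := mem_range.1 hj; omega)) (sq_nonneg _)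
    · have h1 := he j (by have := mem_range.1 hj; omega)
      have h2 := he (j + 1) (by have := mem_range.1 hj; omega)
      exact mul_le_mul_of_nonneg_right (by linarith) (sq_nonneg _)
  refine this.trans (le_of_eq ?_)
  rw [weightedEnergy_eq, weightedEnergy_eq, weightedMass_const]
  simp only [← mul_sum]
  ring

theorem weightedJump_le_const {N : ℕ} {h M : ℝ} {e : ℕ → ℝ} (hh : 0 ≤ h) (he : ∀ j ≤ N + 1, e j ≤ M)
    (x : ℕ → ℝ) : weightedJump N h e x ≤ M * weightedJump N h (fun _ => 1) x := by
  simp only [weightedJump, mul_sum]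
  refine sum_le_sum fun j hj => ?_
  have h1 := he j (by have := mem_range.1 hj; omega)
  have h2 := he (j + 1) (by have := mem_range.1 hj; omega)
  have := mul_le_mul_of_nonneg_right (show (e j + e (j + 1)) / 2 ≤ M by linarith)
    (mul_nonneg hh (sq_nonneg (x (j + 1) - x j)))
  linarith

namespace IsLinearizedWave

variable {N : ℕ} {T m : ℝ} {q f y0 : ℕ → ℝ} {κ : ℝ → ℝ} {Y w v a : ℕ → ℝ → ℝ}

theorem continuousOn_forwardDiff (H : IsLinearizedWave N T m q f y0 κ Y w v a) {j : ℕ}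
    (hj : j ≤ N) : ContinuousOn (fun t => forwardDiff N (fun i => w i t) j) (Icc 0 T) :=
  ((H.continuousOn_w _ (by omega)).sub (H.continuousOn_w _ (by omega))).div_const _

theorem hasDerivAt_forwardDiff (H : IsLinearizedWave N T m q f y0 κ Y w v a) {j : ℕ}
    (hj : j ≤ N) {t : ℝ} (ht : t ∈ Ioo 0 T) :
    HasDerivAt (fun t => forwardDiff N (fun i => w i t) j) ((v (j + 1) t - v j t) / meshSize N) t :=
  ((H.hasDerivAt_w _ (by omega) t ht).sub (H.hasDerivAt_w _ (by omega) t ht)).div_const _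

theorem continuousOn_mass (H : IsLinearizedWave N T m q f y0 κ Y w v a) (h : ℝ) (e : ℕ → ℝ) :
    ContinuousOn (fun t => weightedMass N h e (fun i => w i t)) (Icc 0 T) :=
  continuousOn_const.mul (continuousOn_finsetSum _ fun j hj => continuousOn_const.mul
    ((H.continuousOn_w _ (by have := mem_range.1 hj; omega)).pow 2))

theorem continuousOn_mass_velocity (H : IsLinearizedWave N T m q f y0 κ Y w v a) (h : ℝ)
    (e : ℕ → ℝ) : ContinuousOn (fun t => weightedMass N h e (fun i => v i t)) (Icc 0 T) :=
  continuousOn_const.mul (continuousOn_finsetSum _ fun j hj => continuousOn_const.mul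
    ((H.continuousOn_v _ (by have := mem_range.1 hj; omega)).pow 2))

theorem continuousOn_energy (H : IsLinearizedWave N T m q f y0 κ Y w v a) (h : ℝ) (e : ℕ → ℝ) :
    ContinuousOn (fun t => weightedEnergy N h e (fun i => v i t)
      (forwardDiff N fun i => w i t)) (Icc 0 T) :=
  continuousOn_const.mul ((continuousOn_finsetSum _ fun j hj => continuousOn_const.mul
    ((H.continuousOn_v _ (by have := mem_range.1 hj; omega)).pow 2)).add
    (continuousOn_finsetSum _ fun j hj => continuousOn_const.mul
    ((H.continuousOn_forwardDiff (by have := mem_range.1 hj; omega)).pow 2)))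

theorem continuousOn_momentum (H : IsLinearizedWave N T m q f y0 κ Y w v a) (h : ℝ) (e : ℕ → ℝ) :
    ContinuousOn (fun t => weightedMomentum N h e (fun i => v i t)
      (forwardDiff N fun i => w i t)) (Icc 0 T) :=
  continuousOn_const.mul (continuousOn_finsetSum _ fun j hj =>
    (H.continuousOn_forwardDiff (by have := mem_range.1 hj; omega)).mul
    ((continuousOn_const.mul (H.continuousOn_v _ (by have := mem_range.1 hj; omega))).add
      (continuousOn_const.mul (H.continuousOn_v _ (by have := mem_range.1 hj; omega)))))

theorem continuousOn_jump (H : IsLinearizedWave N T m q f y0 κ Y w v a) (h : ℝ) (e : ℕ → ℝ) :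
    ContinuousOn (fun t => weightedJump N h e (fun i => v i t)) (Icc 0 T) :=
  continuousOn_const.mul (continuousOn_finsetSum _ fun j hj => continuousOn_const.mul
    (((H.continuousOn_v _ (by have := mem_range.1 hj; omega)).sub
      (H.continuousOn_v _ (by have := mem_range.1 hj; omega))).pow 2))

theorem hasDerivAt_mass (H : IsLinearizedWave N T m q f y0 κ Y w v a) (h : ℝ) (e : ℕ → ℝ) {t : ℝ}
    (ht : t ∈ Ioo 0 T) :
    HasDerivAt (fun t => weightedMass N h e (fun i => w i t))
      (h * ∑ j ∈ range N, e (j + 1) * (w (j + 1) t * v (j + 1) t)) t := by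
  have := (HasDerivAt.fun_sum (u := range N) fun j hj => ((H.hasDerivAt_w (j + 1)
    (by have := mem_range.1 hj; omega) t ht).pow 2).const_mul (e (j + 1))).const_mul (h / 2)
  refine this.congr_deriv ?_
  rw [mul_sum, mul_sum]
  exact sum_congr rfl fun j _ => by simp; ring

theorem hasDerivAt_mass_velocity (H : IsLinearizedWave N T m q f y0 κ Y w v a) (h : ℝ)
    (e : ℕ → ℝ) {t : ℝ} (ht : t ∈ Ioo 0 T) :
    HasDerivAt (fun t => weightedMass N h e (fun i => v i t))
      (h * ∑ j ∈ range N, e (j + 1) * (v (j + 1) t * a (j + 1) t)) t := by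
  have := (HasDerivAt.fun_sum (u := range N) fun j hj => ((H.hasDerivAt_v (j + 1)
    (by have := mem_range.1 hj; omega) t ht).pow 2).const_mul (e (j + 1))).const_mul (h / 2)
  refine this.congr_deriv ?_
  rw [mul_sum, mul_sum]
  exact sum_congr rfl fun j _ => by simp; ring

theorem hasDerivAt_energy (H : IsLinearizedWave N T m q f y0 κ Y w v a) (e : ℕ → ℝ) {t : ℝ}
    (ht : t ∈ Ioo 0 T) :
    HasDerivAt (fun t => weightedEnergy N (meshSize N) e (fun i => v i t)
        (forwardDiff N fun i => w i t))
      (meshSize N * ∑ j ∈ range N, e (j + 1) * (v (j + 1) t * a (j + 1) t) +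
        ∑ j ∈ range (N + 1), (e j + e (j + 1)) / 2 *
          (forwardDiff N (fun i => w i t) j * (v (j + 1) t - v j t))) t := by
  have h1 := H.hasDerivAt_mass_velocity (meshSize N) e ht
  have h2 := (HasDerivAt.fun_sum (u := range (N + 1)) fun j hj => ((H.hasDerivAt_forwardDiff (j := j)
    (by have := mem_range.1 hj; omega) ht).pow 2).const_mul
      ((e j + e (j + 1)) / 2)).const_mul (meshSize N / 2)
  have h3 := h1.add h2
  refine (h3.congr_deriv ?_).congr_of_eventuallyEq
    (Filter.Eventually.of_forall fun s => weightedEnergy_eq _ _ _ _ _)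
  congr 1
  rw [mul_sum]
  refine sum_congr rfl fun j _ => ?_
  have := (meshSize_pos N).ne'
  simp only [Nat.cast_ofNat, Nat.add_one_sub_one, pow_one]
  field_simp

theorem hasDerivAt_momentum (H : IsLinearizedWave N T m q f y0 κ Y w v a) (e : ℕ → ℝ) {t : ℝ}
    (ht : t ∈ Ioo 0 T) :
    HasDerivAt (fun t => weightedMomentum N (meshSize N) e (fun i => v i t)
        (forwardDiff N fun i => w i t))
      (1 / 2 * ∑ j ∈ range (N + 1), (v (j + 1) t - v j t) *
          (e j * v j t + e (j + 1) * v (j + 1) t) +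
        meshSize N / 2 * ∑ j ∈ range (N + 1), forwardDiff N (fun i => w i t) j *
          (e j * a j t + e (j + 1) * a (j + 1) t)) t := by
  have h1 := (HasDerivAt.fun_sum (u := range (N + 1)) fun j hj =>
    (H.hasDerivAt_forwardDiff (j := j) (by have := mem_range.1 hj; omega) ht).mul
    (((H.hasDerivAt_v j (by have := mem_range.1 hj; omega) t ht).const_mul (e j)).add
      ((H.hasDerivAt_v (j + 1) (by have := mem_range.1 hj; omega) t ht).const_mul
        (e (j + 1))))).const_mul (meshSize N / 2)
  refine h1.congr_deriv ?_
  rw [mul_sum, mul_sum, mul_sum, ← sum_add_distrib]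
  refine sum_congr rfl fun j _ => ?_
  have := (meshSize_pos N).ne'
  simp only [Pi.add_apply]
  field_simp

theorem forwardDiff_zero (H : IsLinearizedWave N T m q f y0 κ Y w v a) {j : ℕ} (hj : j ≤ N) :
    forwardDiff N (fun i => w i 0) j = 0 := by
  simp [forwardDiff, H.w_zero j (by omega), H.w_zero (j + 1) (by omega)]

theorem mass_zero (H : IsLinearizedWave N T m q f y0 κ Y w v a) (h : ℝ) (e : ℕ → ℝ) :
    weightedMass N h e (fun i => w i 0) = 0 := by
  unfold weightedMass
  rw [sum_eq_zero, mul_zero]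
  intro j hj
  simp [H.w_zero (j + 1) (by have := mem_range.1 hj; omega)]

theorem momentum_zero (H : IsLinearizedWave N T m q f y0 κ Y w v a) (h : ℝ) (e : ℕ → ℝ) :
    weightedMomentum N h e (fun i => v i 0) (forwardDiff N fun i => w i 0) = 0 := by
  unfold weightedMomentum
  rw [sum_eq_zero, mul_zero]
  intro j hj
  rw [H.forwardDiff_zero (by have := mem_range.1 hj; omega), zero_mul]

theorem energy_zero (H : IsLinearizedWave N T m q f y0 κ Y w v a) (h : ℝ) (e : ℕ → ℝ) :
    weightedEnergy N h e (fun i => v i 0) (forwardDiff N fun i => w i 0) =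
      weightedMass N h e (fun i => v i 0) := by
  rw [weightedEnergy_eq, add_eq_left, sum_eq_zero, mul_zero]
  intro j hj
  rw [H.forwardDiff_zero (by have := mem_range.1 hj; omega)]
  ring

theorem mul_mass_le (H : IsLinearizedWave N T m q f y0 κ Y w v a) {h r : ℝ} {e : ℕ → ℝ}
    (hh : 0 ≤ h) (he : ∀ j, 0 ≤ e j) (hr : 0 ≤ r) (hy : ∀ j ∈ range N, r ≤ |y0 (j + 1)|) :
    r ^ 2 * weightedMass N h e f ≤ weightedMass N h e (fun i => v i 0) := by
  simp only [weightedMass, mul_sum]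
  refine sum_le_sum fun j hj => ?_
  rw [H.v_zero j hj]
  have h1 : r ^ 2 ≤ y0 (j + 1) ^ 2 := by
    rw [← sq_abs (y0 _)]; exact pow_le_pow_left₀ hr (hy j hj) 2
  have h2 := mul_le_mul_of_nonneg_left h1 (show 0 ≤ h / 2 * (e (j + 1) * f (j + 1) ^ 2) from
    mul_nonneg (by positivity) (mul_nonneg (he _) (sq_nonneg _)))
  linarith

/-- The energy at time `T` is controlled by the initial energy and the source. -/
theorem energy_final_le (H : IsLinearizedWave N T m q f y0 κ Y w v a) (hT : 0 < T) (hm : 0 < m) :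
    weightedEnergy N (meshSize N) (fun _ => 1) (fun i => v i T) (forwardDiff N fun i => w i T) ≤
      Real.exp ((m + 2) * T) * (weightedMass N (meshSize N) (fun _ => 1) (fun i => v i 0) +
        (∫ t in (0 : ℝ)..T, κ t) * weightedMass N (meshSize N) (fun _ => 1) f) := by
  have hh := meshSize_pos N
  set F := weightedMass N (meshSize N) (fun _ => 1) f with hF
  have hF0 : 0 ≤ F := weightedMass_nonneg hh.le (fun _ => zero_le_one) f
  have h0 : (0 : ℝ) ∈ Icc 0 T := ⟨le_rfl, hT.le⟩
  set S : ℝ → ℝ := fun t => weightedEnergy N (meshSize N) (fun _ => 1) (fun i => v i t)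
    (forwardDiff N fun i => w i t) + weightedMass N (meshSize N) (fun _ => 1) (fun i => w i t)
    with hS
  have h1 := intervalIntegral.sub_le_integral_of_hasDeriv_right_of_le (a := 0) (b := T) hT.le
    (g := fun t => Real.exp (-((m + 2) * t)) * S t)
    (g' := fun t => Real.exp (-((m + 2) * t)) * (((meshSize N * ∑ j ∈ range N,
        1 * (v (j + 1) t * a (j + 1) t) + ∑ j ∈ range (N + 1), ((1 : ℝ) + 1) / 2 *
          (forwardDiff N (fun i => w i t) j * (v (j + 1) t - v j t))) +
        meshSize N * ∑ j ∈ range N, 1 * (w (j + 1) t * v (j + 1) t)) - (m + 2) * S t))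
    (φ := fun t => κ t * F) ?_ ?_ (H.continuousOn_κ.mul continuousOn_const).integrableOn_Icc ?_
  · have hS0 : S 0 = weightedMass N (meshSize N) (fun _ => 1) (fun i => v i 0) := by
      simp only [hS]; rw [H.energy_zero, H.mass_zero, add_zero]
    simp only [mul_zero, neg_zero, Real.exp_zero, one_mul, hS0] at h1
    rw [intervalIntegral.integral_mul_const, sub_le_iff_le_add'] at h1
    have h2 := mul_le_mul_of_nonneg_left h1 (Real.exp_pos ((m + 2) * T)).le
    rw [← mul_assoc, ← Real.exp_add, add_neg_cancel, Real.exp_zero, one_mul] at h2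
    refine le_trans ?_ h2
    have := weightedMass_nonneg (N := N) (e := fun _ => 1) hh.le (fun _ => zero_le_one)
      (fun i => w i T)
    simp only [hS]
    linarith
  · exact ContinuousOn.mul (by fun_prop) ((H.continuousOn_energy _ _).add (H.continuousOn_mass _ _))
  · intro t ht
    have h2 : HasDerivAt (fun t => Real.exp (-((m + 2) * t)))
        (Real.exp (-((m + 2) * t)) * -(m + 2)) t := by
      simpa using (((hasDerivAt_id t).const_mul (m + 2)).neg).exp
    exact ((h2.mul ((H.hasDerivAt_energy (fun _ => 1) ht).add
      (H.hasDerivAt_mass (meshSize N) (fun _ => 1) ht))).congr_deriv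
        (by simp only [hS, Pi.add_apply]; ring)).hasDerivWithinAt
  · intro t ht
    have htc := Ioo_subset_Icc_self ht
    have h3 : Real.exp (-((m + 2) * t)) ≤ 1 := by
      rw [Real.exp_le_one_iff]
      have := mul_nonneg (show 0 ≤ m + 2 by linarith) ht.1.le
      linarith
    have h4 := weightedEnergy_growth_le (h := meshSize N) (κ := κ t)
      (v := fun i => v i t) (d := forwardDiff N fun i => w i t) (w := fun i => w i t)
      (a := fun i => a i t) (q := q) (f := f) (Y := fun i => Y i t) hh hm (H.v_left t htc)
      (H.v_right t htc) (H.equation t ht) H.abs_q_le (H.sq_Y_le t ht)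
    have h5 : 0 ≤ κ t * F := mul_nonneg (H.κ_nonneg t htc) hF0
    calc _ ≤ Real.exp (-((m + 2) * t)) * (κ t * F) :=
          mul_le_mul_of_nonneg_left (by simp only [hS]; linarith) (Real.exp_pos _).le
      _ ≤ 1 * (κ t * F) := mul_le_mul_of_nonneg_right h3 h5
      _ = _ := one_mul _

/-- Carleman estimate on fine grids. -/
theorem initial_energy_le_of_fine (H : IsLinearizedWave N T m q f y0 κ Y w v a) (hT : 0 < T)
    {μ c M : ℝ} {e : ℕ → ℝ} (hμ : 0 < μ) (hc : 0 < c) (hc' : c ≤ 1 / 2)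
    (hμh : μ * meshSize N ≤ 2) (hμc : 4 ≤ c * μ ^ 2) (hμm : 48 * m ^ 2 ≤ c * μ ^ 2)
    (he : IsExpWeight (meshSize N) μ e) (heM : ∀ j ≤ N + 1, e j ≤ M) :
    weightedMass N (meshSize N) e (fun i => v i 0) ≤
      3 * (Real.exp (-((1 - c) * μ * T)) * M) * weightedEnergy N (meshSize N) (fun _ => 1)
        (fun i => v i T) (forwardDiff N fun i => w i T) +
      (M * (∫ t in (0 : ℝ)..T, forwardDiff N (fun i => w i t) N ^ 2) +
      μ * (1 / 2 + 1 / (8 * c)) * M *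
        (∫ t in (0 : ℝ)..T, weightedJump N (meshSize N) (fun _ => 1) (fun i => v i t))) +
      12 / (c * μ) * (∫ t in (0 : ℝ)..T, κ t) * weightedMass N (meshSize N) e f := by
  have hh := meshSize_pos N
  have he0 : ∀ j, 0 ≤ e j := fun j => (he.pos j).le
  have hTm : T ∈ Icc 0 T := ⟨hT.le, le_rfl⟩
  set F := weightedMass N (meshSize N) e f with hF
  have hF0 : 0 ≤ F := weightedMass_nonneg hh.le he0 f
  have hM : 0 ≤ M := (he0 0).trans (heM 0 (by omega))
  have hJ0 : ∀ t, 0 ≤ weightedJump N (meshSize N) (fun _ => 1) (fun i => v i t) := fun t =>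
    weightedJump_nonneg hh.le (fun _ => zero_le_one) _
  have hB : ContinuousOn (fun t => M * forwardDiff N (fun i => w i t) N ^ 2) (Icc 0 T) :=
    continuousOn_const.mul ((H.continuousOn_forwardDiff le_rfl).pow 2)
  have hJ : ContinuousOn (fun t => μ * (1 / 2 + 1 / (8 * c)) * M *
      weightedJump N (meshSize N) (fun _ => 1) (fun i => v i t)) (Icc 0 T) :=
    continuousOn_const.mul (H.continuousOn_jump _ _)
  have hK : ContinuousOn (fun t => 12 / (c * μ) * F * κ t) (Icc 0 T) :=
    continuousOn_const.mul H.continuousOn_κ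
  have h1 := le_exp_mul_add_integral (γ := (1 - c) * μ) hT.le (mul_nonneg (by linarith) hμ.le)
    (((H.continuousOn_energy (meshSize N) e).sub
      ((continuousOn_const (c := (2 : ℝ))).mul (H.continuousOn_momentum (meshSize N) e))).sub
        (H.continuousOn_mass (meshSize N) e))
    (fun t ht => ((H.hasDerivAt_energy e ht).sub ((H.hasDerivAt_momentum e ht).const_mul 2)).sub
      (H.hasDerivAt_mass (meshSize N) e ht)) ((hB.add hJ).add hK) ?_ ?_
  · have hu : uIcc 0 T = Icc 0 T := uIcc_of_le hT.le
    simp only [Pi.add_apply, Pi.sub_apply, Pi.mul_apply] at h1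
    rw [intervalIntegral.integral_add ((hu ▸ hB).add (hu ▸ hJ)).intervalIntegrable
      (hu ▸ hK).intervalIntegrable, intervalIntegral.integral_add (hu ▸ hB).intervalIntegrable
      (hu ▸ hJ).intervalIntegrable, intervalIntegral.integral_const_mul,
      intervalIntegral.integral_const_mul, intervalIntegral.integral_const_mul, H.energy_zero,
      H.momentum_zero, H.mass_zero] at h1
    -- At the final time |P| ≤ E and W ≥ 0 give Q ≤ 3E, hence the factor 3.
    have h2 := abs_le.1 (abs_weightedMomentum_le (v := fun i => v i T) hh.le he0 (forwardDiff N fun i => w i T)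
      (H.v_left T hTm) (H.v_right T hTm))
    have h3 := weightedEnergy_le_const hh.le heM (fun i => v i T) (forwardDiff N fun i => w i T)
    have h4 := weightedMass_nonneg (N := N) hh.le he0 (fun i => w i T)
    have h5 := mul_le_mul_of_nonneg_left (show
      weightedEnergy N (meshSize N) e (fun i => v i T) (forwardDiff N fun i => w i T) -
      2 * weightedMomentum N (meshSize N) e (fun i => v i T) (forwardDiff N fun i => w i T) -
      weightedMass N (meshSize N) e (fun i => w i T) ≤ 3 * (M * weightedEnergy N (meshSize N)
        (fun _ => 1) (fun i => v i T) (forwardDiff N fun i => w i T)) by linarith [h2.1])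
      (Real.exp_pos (-((1 - c) * μ * T))).le
    linarith
  · intro t ht
    have := H.κ_nonneg t (Ioo_subset_Icc_self ht)
    have := hJ0 t
    simp only [Pi.add_apply]
    positivity
  · intro t ht
    have htc := Ioo_subset_Icc_self ht
    have h4 := carleman_rate_le (κ := κ t) (v := fun i => v i t) (d := forwardDiff N fun i => w i t)
      (w := fun i => w i t) (a := fun i => a i t) (Y := fun i => Y i t) (q := q) (f := f) hh hμ hc hc' hμh hμc hμm
      he (H.v_left t htc) (H.v_right t htc) (H.a_left t ht) (H.a_right t ht) (H.equation t ht)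
      H.abs_q_le (H.sq_Y_le t ht)
    have h5 := weightedJump_le_const hh.le heM (fun i => v i t)
    have h6 := mul_le_mul_of_nonneg_left h5 (show 0 ≤ μ * (1 / 2 + 1 / (8 * c)) by positivity)
    have h7 := mul_le_mul_of_nonneg_right (heM (N + 1) le_rfl)
      (sq_nonneg (forwardDiff N (fun i => w i t) N))
    simp only [Pi.add_apply, Pi.sub_apply, Pi.mul_apply]
    linarith

/-- On coarse grids the jump term alone controls the kinetic energy. -/
theorem initial_energy_le_of_coarse (H : IsLinearizedWave N T m q f y0 κ Y w v a) (hT : 0 < T)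
    {γ : ℝ} (hγ : 0 < γ) (hγm : 2 * m ^ 2 ≤ γ ^ 2) :
    weightedMass N (meshSize N) (fun _ => 1) (fun i => v i 0) ≤
      Real.exp (-(γ * T)) * weightedEnergy N (meshSize N) (fun _ => 1)
        (fun i => v i T) (forwardDiff N fun i => w i T) +
      (3 * γ + 4 / γ) / meshSize N ^ 2 *
        (∫ t in (0 : ℝ)..T, weightedJump N (meshSize N) (fun _ => 1) (fun i => v i t)) +
      1 / γ * (∫ t in (0 : ℝ)..T, κ t) * weightedMass N (meshSize N) (fun _ => 1) f := by
  have hh := meshSize_pos N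
  have he0 : ∀ j : ℕ, (0 : ℝ) ≤ (fun _ : ℕ => (1 : ℝ)) j := fun _ => zero_le_one
  set F := weightedMass N (meshSize N) (fun _ => 1) f with hF
  have hF0 : 0 ≤ F := weightedMass_nonneg hh.le he0 f
  have hJ0 : ∀ t, 0 ≤ weightedJump N (meshSize N) (fun _ => 1) (fun i => v i t) := fun t =>
    weightedJump_nonneg hh.le (fun _ => zero_le_one) _
  have hJ : ContinuousOn (fun t => (3 * γ + 4 / γ) / meshSize N ^ 2 *
      weightedJump N (meshSize N) (fun _ => 1) (fun i => v i t)) (Icc 0 T) :=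
    continuousOn_const.mul (H.continuousOn_jump _ _)
  have hK : ContinuousOn (fun t => 1 / γ * F * κ t) (Icc 0 T) :=
    continuousOn_const.mul H.continuousOn_κ
  have h1 := le_exp_mul_add_integral (γ := γ) hT.le hγ.le
    ((((continuousOn_const (c := (2 : ℝ))).mul
      (H.continuousOn_mass_velocity (meshSize N) fun _ => 1)).sub
      (H.continuousOn_energy (meshSize N) fun _ => 1)).sub
        (H.continuousOn_mass (meshSize N) fun _ => 1))
    (fun t ht => (((H.hasDerivAt_mass_velocity (meshSize N) (fun _ => 1) ht).const_mul 2).sub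
      (H.hasDerivAt_energy (fun _ => 1) ht)).sub
      (H.hasDerivAt_mass (meshSize N) (fun _ => 1) ht)) (hJ.add hK) ?_ ?_
  · have hu : uIcc 0 T = Icc 0 T := uIcc_of_le hT.le
    simp only [Pi.add_apply, Pi.sub_apply, Pi.mul_apply] at h1
    rw [intervalIntegral.integral_add (hu ▸ hJ).intervalIntegrable
      (hu ▸ hK).intervalIntegrable, intervalIntegral.integral_const_mul,
      intervalIntegral.integral_const_mul, H.energy_zero, H.mass_zero] at h1
    have h3 := weightedMass_le_weightedEnergy (N := N) hh.le he0 (fun i => v i T)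
      (forwardDiff N fun i => w i T)
    have h4 := weightedMass_nonneg (N := N) hh.le he0 (fun i => w i T)
    have h5 := mul_le_mul_of_nonneg_left (show
      2 * weightedMass N (meshSize N) (fun _ => 1) (fun i => v i T) -
      weightedEnergy N (meshSize N) (fun _ => 1) (fun i => v i T) (forwardDiff N fun i => w i T) -
      weightedMass N (meshSize N) (fun _ => 1) (fun i => w i T) ≤ weightedEnergy N (meshSize N)
        (fun _ => 1) (fun i => v i T) (forwardDiff N fun i => w i T) by linarith)
      (Real.exp_pos (-(γ * T))).le
    linarith
  · intro t ht
    have := H.κ_nonneg t (Ioo_subset_Icc_self ht)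
    have := hJ0 t
    simp only [Pi.add_apply]
    positivity
  · intro t ht
    have htc := Ioo_subset_Icc_self ht
    have h4 := coarse_rate_le (κ := κ t) (v := fun i => v i t) (d := forwardDiff N fun i => w i t)
      (w := fun i => w i t) (a := fun i => a i t) (Y := fun i => Y i t) (q := q) (f := f) (meshSize_mul N) hγ hγm
      (H.v_left t htc) (H.v_right t htc) (H.equation t ht) H.abs_q_le (H.sq_Y_le t ht)
    simp only [Pi.add_apply, Pi.sub_apply, Pi.mul_apply]
    have : κ t / γ * F = 1 / γ * F * κ t := by ring
    linarith

end IsLinearizedWave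

/-! ### Choice of the parameters, absorption and the uniform constant. -/

theorem exists_large_parameter {c g m K r A : ℝ} (hc : 0 < c) (hg : 0 < g) (hr : 0 < r) :
    ∃ μ : ℝ, 0 < μ ∧ 4 ≤ c * μ ^ 2 ∧ 48 * m ^ 2 ≤ c * μ ^ 2 ∧ 12 / (c * μ) * K ^ 2 ≤ r ^ 2 / 4 ∧
      A * Real.exp (-(g * μ)) ≤ 1 / 4 := by
  have h1 : Tendsto (fun μ : ℝ => c * μ ^ 2) atTop atTop :=
    (tendsto_pow_atTop two_ne_zero).const_mul_atTop hc
  have h2 : Tendsto (fun μ : ℝ => c * μ) atTop atTop := tendsto_id.const_mul_atTop hc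
  have h3 : Tendsto (fun μ : ℝ => 12 / (c * μ) * K ^ 2) atTop (𝓝 0) := by
    simpa using (h2.const_div_atTop 12).mul_const (K ^ 2)
  have h4 : Tendsto (fun μ : ℝ => A * Real.exp (-(g * μ))) atTop (𝓝 0) := by
    simpa using (Real.tendsto_exp_neg_atTop_nhds_zero.comp
      (tendsto_id.const_mul_atTop hg)).const_mul A
  obtain ⟨μ, hμ⟩ := ((eventually_gt_atTop 0).and ((h1.eventually_ge_atTop 4).and
    ((h1.eventually_ge_atTop (48 * m ^ 2)).and ((h3.eventually_le_const
      (show (0 : ℝ) < r ^ 2 / 4 by positivity)).and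
        (h4.eventually_le_const (show (0 : ℝ) < 1 / 4 by norm_num)))))).exists
  exact ⟨μ, hμ⟩

/-- Closing the estimate: `X` is the weighted initial kinetic energy, `F` the weighted and `F₁`
the unweighted size of the unknown potential, `B` the observation. -/
theorem le_of_absorption {X F F₁ X₁ E B θ A K I r ε : ℝ} (hF₁ : F₁ ≤ F)
    (hF₁0 : 0 ≤ F₁) (hX₁ : X₁ ≤ X) (hA : 0 ≤ A) (hI : I ≤ K ^ 2)
    (hθ : 0 ≤ θ) (hr : 0 < r) (hF : r ^ 2 * F ≤ X) (hE : E ≤ A * (X₁ + I * F₁))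
    (hε : 0 ≤ ε) (hεK : ε * K ^ 2 ≤ r ^ 2 / 4) (hθA : A * (1 + K ^ 2 / r ^ 2) * θ ≤ 1 / 4)
    (hX : X ≤ θ * E + B + ε * I * F) : F₁ ≤ 2 / r ^ 2 * B := by
  have hF0 : 0 ≤ F := hF₁0.trans hF₁
  have hX0 : 0 ≤ X := le_trans (by positivity) hF
  have h1 : I * F₁ ≤ K ^ 2 / r ^ 2 * X := by
    calc I * F₁ ≤ K ^ 2 * F := mul_le_mul hI hF₁ hF₁0 (sq_nonneg K)
      _ = K ^ 2 / r ^ 2 * (r ^ 2 * F) := by field_simp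
      _ ≤ K ^ 2 / r ^ 2 * X := mul_le_mul_of_nonneg_left hF (by positivity)
  have h2 : θ * E ≤ 1 / 4 * X := by
    calc θ * E ≤ θ * (A * (X + K ^ 2 / r ^ 2 * X)) := by
          refine mul_le_mul_of_nonneg_left (hE.trans ?_) hθ
          exact mul_le_mul_of_nonneg_left (add_le_add hX₁ h1) hA
      _ = A * (1 + K ^ 2 / r ^ 2) * θ * X := by ring
      _ ≤ 1 / 4 * X := mul_le_mul_of_nonneg_right hθA hX0
  have h3 : ε * I * F ≤ 1 / 4 * X := by
    calc ε * I * F ≤ ε * K ^ 2 * F :=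
          mul_le_mul_of_nonneg_right (mul_le_mul_of_nonneg_left hI hε) hF0
      _ ≤ r ^ 2 / 4 * F := mul_le_mul_of_nonneg_right hεK hF0
      _ ≤ 1 / 4 * X := by linarith
  -- The final energy and the source each cost at most X/4, so half of X survives and X ≤ 2B.
  have h4 : r ^ 2 * F₁ ≤ 2 * B := by
    have := mul_le_mul_of_nonneg_left hF₁ (sq_nonneg r)
    linarith
  rw [div_mul_eq_mul_div, le_div_iff₀ (by positivity)]
  linarith

theorem IsLinearizedWave.mass_source_le_of_fine {N : ℕ} {T m c μ K r : ℝ} {q f y0 : ℕ → ℝ}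
    {κ : ℝ → ℝ} {Y w v a : ℕ → ℝ → ℝ} (H : IsLinearizedWave N T m q f y0 κ Y w v a)
    (hT : 1 < T) (hm : 0 < m) (hr : 0 < r) (hμ : 0 < μ) (hcT : c = (T - 1) / (2 * T))
    (hμc : 4 ≤ c * μ ^ 2) (hμm : 48 * m ^ 2 ≤ c * μ ^ 2) (hμK : 12 / (c * μ) * K ^ 2 ≤ r ^ 2 / 4)
    (hμA : 3 * Real.exp ((m + 2) * T) * (1 + K ^ 2 / r ^ 2) * Real.exp (-((T - 1) / 4 * μ)) ≤ 1 / 4)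
    (hκ : (∫ t in (0 : ℝ)..T, κ t) ≤ K ^ 2) (hy : ∀ j ∈ range N, r ≤ |y0 (j + 1)|)
    (hfine : μ / 2 * meshSize N ≤ (T - 1) / (T + 3)) :
    weightedMass N (meshSize N) (fun _ => 1) f ≤ 2 / r ^ 2 *
      (Real.exp (μ * ((T + 3) / 4)) * (∫ t in (0 : ℝ)..T, forwardDiff N (fun i => w i t) N ^ 2) +
        μ * (1 / 2 + 1 / (8 * c)) * Real.exp (μ * ((T + 3) / 4)) *
          ∫ t in (0 : ℝ)..T, weightedJump N (meshSize N) (fun _ => 1) (fun i => v i t)) := by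
  have hT0 : 0 < T := by linarith
  have hT1 : 0 < T - 1 := by linarith
  have hT3 : 0 < T + 3 := by linarith
  have hc : 0 < c := by rw [hcT]; positivity
  have hc' : c ≤ 1 / 2 := by rw [hcT, div_le_div_iff₀ (by positivity) (by norm_num)]; linarith
  have hh := meshSize_pos N
  have hF0 := weightedMass_nonneg (N := N) (e := fun _ => 1) hh.le (fun _ => zero_le_one) f
  -- The fine-grid threshold (T − 1)/(T + 3) is chosen so that 1/(1 − μh/2) ≤ (T + 3)/4, a bound on
  -- the exponent of the weight independent of h.
  have hδ : 1 - (T - 1) / (T + 3) = ((T + 3) / 4)⁻¹ := by field_simp; ring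
  have hδ' : 0 < ((T + 3) / 4)⁻¹ := by positivity
  have hσh : μ / 2 * meshSize N < 1 := by linarith
  have he := geomWeight_isExpWeight hh (half_pos hμ) hσh
  rw [mul_div_cancel₀ _ (two_ne_zero' ℝ)] at he
  have he1 := one_le_geomWeight hh (half_pos hμ) hσh
  have heM : ∀ j ≤ N + 1, geomWeight (meshSize N) (μ / 2) j ≤ Real.exp (μ * ((T + 3) / 4)) := by
    intro j hj
    refine (geomWeight_le (meshSize_mul N) hh (half_pos hμ) hσh hj).trans ?_
    rw [Real.exp_le_exp, mul_div_cancel₀ _ (two_ne_zero' ℝ), div_eq_mul_inv]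
    refine mul_le_mul_of_nonneg_left ?_ hμ.le
    rw [inv_le_comm₀ (by linarith) (by positivity)]
    linarith
  have h1 := H.initial_energy_le_of_fine hT0 hμ hc hc' (by linarith) hμc hμm he heM
  -- With this c one has (1 − c)T = (T + 1)/2, which exceeds (T + 3)/4 by (T − 1)/4: decay in time
  -- beats growth of the weight exactly when T > 1.
  have hexp : Real.exp (-((1 - c) * μ * T)) * Real.exp (μ * ((T + 3) / 4)) =
      Real.exp (-((T - 1) / 4 * μ)) := by
    rw [← Real.exp_add, hcT]
    congr 1
    field_simp
    ring
  rw [hexp] at h1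
  exact le_of_absorption (weightedMass_mono hh.le (fun j _ => he1 j) f) hF0
    (weightedMass_mono hh.le (fun j _ => he1 j) _) (Real.exp_pos _).le hκ
    (mul_nonneg zero_le_three (Real.exp_pos _).le) hr
    (H.mul_mass_le hh.le (fun j => (he.pos j).le) hr.le hy) (H.energy_final_le hT0 hm)
    (div_nonneg (by norm_num) (mul_pos hc hμ).le) hμK (by linarith) h1

theorem IsLinearizedWave.mass_source_le_of_coarse {N : ℕ} {T m μ K r : ℝ} {q f y0 : ℕ → ℝ}
    {κ : ℝ → ℝ} {Y w v a : ℕ → ℝ → ℝ} (H : IsLinearizedWave N T m q f y0 κ Y w v a)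
    (hT : 0 < T) (hm : 0 < m) (hr : 0 < r) (hμ : 0 < μ) (hμm : 2 * m ^ 2 ≤ μ ^ 2)
    (hμK : 1 / μ * K ^ 2 ≤ r ^ 2 / 4)
    (hμA : Real.exp ((m + 2) * T) * (1 + K ^ 2 / r ^ 2) * Real.exp (-(μ * T)) ≤ 1 / 4)
    (hκ : (∫ t in (0 : ℝ)..T, κ t) ≤ K ^ 2) (hy : ∀ j ∈ range N, r ≤ |y0 (j + 1)|) :
    weightedMass N (meshSize N) (fun _ => 1) f ≤ 2 / r ^ 2 * ((3 * μ + 4 / μ) / meshSize N ^ 2 *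
      ∫ t in (0 : ℝ)..T, weightedJump N (meshSize N) (fun _ => 1) (fun i => v i t)) := by
  have hh := meshSize_pos N
  exact le_of_absorption le_rfl
    (weightedMass_nonneg (N := N) (e := fun _ => 1) hh.le (fun _ => zero_le_one) f)
    le_rfl (Real.exp_pos _).le hκ (Real.exp_pos _).le hr
    (H.mul_mass_le hh.le (fun j => zero_le_one) hr.le hy) (H.energy_final_le hT hm)
    (one_div_nonneg.2 hμ.le) hμK hμA (H.initial_energy_le_of_coarse hT hμ hμm)

theorem exists_stability_constant (T m K r : ℝ) (hT : 1 < T) (hm : 0 < m) (hr : 0 < r) :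
    ∃ C : ℝ, 0 < C ∧ ∀ (N : ℕ) (q f y0 : ℕ → ℝ) (κ : ℝ → ℝ) (Y w v a : ℕ → ℝ → ℝ),
      IsLinearizedWave N T m q f y0 κ Y w v a → (∫ t in (0 : ℝ)..T, κ t) ≤ K ^ 2 →
      (∀ j ∈ range N, r ≤ |y0 (j + 1)|) →
      weightedMass N (meshSize N) (fun _ => 1) f ≤
        C * ((∫ t in (0 : ℝ)..T, forwardDiff N (fun i => w i t) N ^ 2) +
          ∫ t in (0 : ℝ)..T, weightedJump N (meshSize N) (fun _ => 1) (fun i => v i t)) := by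
  have hT0 : 0 < T := by linarith
  have hT1 : 0 < T - 1 := by linarith
  obtain ⟨c, hcT⟩ : ∃ c : ℝ, c = (T - 1) / (2 * T) := ⟨_, rfl⟩
  have hc : 0 < c := by rw [hcT]; positivity
  have hc' : c ≤ 1 / 2 := by rw [hcT, div_le_div_iff₀ (by positivity) (by norm_num)]; linarith
  obtain ⟨μ, hμ, hμc, hμm, hμK, hμA⟩ := exists_large_parameter (c := c) (g := (T - 1) / 4) (m := m)
    (K := K) (r := r) (A := 3 * Real.exp ((m + 2) * T) * (1 + K ^ 2 / r ^ 2)) hc (by linarith) hr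
  obtain ⟨δ, hδ_def⟩ : ∃ δ : ℝ, δ = (T - 1) / (T + 3) := ⟨_, rfl⟩
  have hδ : 0 < δ := by rw [hδ_def]; exact div_pos hT1 (by linarith)
  obtain ⟨D₁, hD₁⟩ : ∃ D : ℝ, D = Real.exp (μ * ((T + 3) / 4)) := ⟨_, rfl⟩
  obtain ⟨D₂, hD₂⟩ : ∃ D : ℝ, D = μ * (1 / 2 + 1 / (8 * c)) * Real.exp (μ * ((T + 3) / 4)) :=
    ⟨_, rfl⟩
  obtain ⟨D₃, hD₃⟩ : ∃ D : ℝ, D = (3 * μ + 4 / μ) * (μ / (2 * δ)) ^ 2 := ⟨_, rfl⟩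
  have hD₁0 : 0 < D₁ := by rw [hD₁]; positivity
  have hD₂0 : 0 < D₂ := by rw [hD₂]; positivity
  have hD₃0 : 0 < D₃ := by rw [hD₃]; positivity
  refine ⟨2 / r ^ 2 * (D₁ + D₂ + D₃), by positivity, fun N q f y0 κ Y w v a H hκ hy => ?_⟩
  have hh := meshSize_pos N
  have hB0 : 0 ≤ ∫ t in (0 : ℝ)..T, forwardDiff N (fun i => w i t) N ^ 2 :=
    intervalIntegral.integral_nonneg hT0.le fun t _ => sq_nonneg _
  have hR0 : 0 ≤ ∫ t in (0 : ℝ)..T, weightedJump N (meshSize N) (fun _ => 1) (fun i => v i t) :=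
    intervalIntegral.integral_nonneg hT0.le fun t _ =>
      weightedJump_nonneg hh.le (fun _ => zero_le_one) _
  rw [mul_assoc (2 / r ^ 2)]
  rcases le_or_gt (μ / 2 * meshSize N) δ with hcase | hcase
  · have h1 := H.mass_source_le_of_fine hT hm hr hμ hcT hμc hμm hμK hμA hκ hy (hδ_def ▸ hcase)
    rw [← hD₂, ← hD₁] at h1
    refine h1.trans (mul_le_mul_of_nonneg_left ?_ (by positivity))
    rw [mul_add]
    exact add_le_add (mul_le_mul_of_nonneg_right (by linarith) hB0)
      (mul_le_mul_of_nonneg_right (by linarith) hR0)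
  -- The coarse estimate reuses the same μ as its rate; since c ≤ 1/2, its smallness conditions
  -- follow from those of the fine regime.
  · have hcμ : c * μ ^ 2 ≤ 1 / 2 * μ ^ 2 := mul_le_mul_of_nonneg_right hc' (sq_nonneg μ)
    have hexp : Real.exp (-(μ * T)) ≤ 3 * Real.exp (-((T - 1) / 4 * μ)) := by
      have h5 : Real.exp (-(μ * T)) ≤ Real.exp (-((T - 1) / 4 * μ)) := by
        rw [Real.exp_le_exp]; nlinarith
      linarith [Real.exp_pos (-((T - 1) / 4 * μ))]
    have hμ1 : 1 / μ * K ^ 2 ≤ r ^ 2 / 4 := by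
      refine le_trans (mul_le_mul_of_nonneg_right ?_ (sq_nonneg K)) hμK
      rw [div_le_div_iff₀ hμ (by positivity)]
      nlinarith
    have hA := mul_le_mul_of_nonneg_left hexp
      (show 0 ≤ Real.exp ((m + 2) * T) * (1 + K ^ 2 / r ^ 2) by positivity)
    have h1 := H.mass_source_le_of_coarse hT0 hm hr hμ (by linarith [sq_nonneg m, sq_nonneg μ])
      hμ1 (by linarith) hκ hy
    refine h1.trans (mul_le_mul_of_nonneg_left ?_ (by positivity))
    -- On coarse grids h > 2δ/μ, so h⁻² is bounded in terms of T, m, K and r only.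
    have h3 : 1 / meshSize N ^ 2 ≤ (μ / (2 * δ)) ^ 2 := by
      rw [← one_div_pow]
      refine pow_le_pow_left₀ (by positivity) ?_ 2
      rw [div_le_div_iff₀ hh (by positivity)]
      linarith
    have h4 : (3 * μ + 4 / μ) / meshSize N ^ 2 ≤ D₃ := by
      have h5 := mul_le_mul_of_nonneg_left h3 (show 0 ≤ 3 * μ + 4 / μ by positivity)
      rwa [mul_one_div, ← hD₃] at h5
    rw [mul_add]
    exact le_add_of_nonneg_of_le (by positivity)
      (mul_le_mul_of_nonneg_right (by linarith) hR0)

/-! ### Reduction to the linearized equation: regularity in time. -/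

/-- Absolute continuity makes u the integral of its a.e. derivative. As this agrees a.e. with a
continuous function, the fundamental theorem of calculus upgrades the derivative to every point,
endpoints included. -/
theorem hasDerivWithinAt_of_absolutelyContinuous {T : ℝ} {u φ : ℝ → ℝ}
    (hu : AbsolutelyContinuousOnInterval u 0 T) (hφ : ContinuousOn φ (Icc 0 T))
    (h : ∀ᵐ t ∂(volume.restrict (Ioo 0 T)), deriv u t = φ t) {t : ℝ} (ht : t ∈ Icc 0 T) :
    HasDerivWithinAt u (φ t) (Icc 0 T) t := by
  have hT : 0 ≤ T := ht.1.trans ht.2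
  have hψ : Continuous (IccExtend hT ((Icc 0 T).domRestrict φ)) :=
    (continuousOn_iff_continuous_domRestrict.1 hφ).Icc_extend'
  set ψ := IccExtend hT ((Icc 0 T).domRestrict φ) with hψ_def
  have hψφ : ∀ s ∈ Icc 0 T, ψ s = φ s := fun s hs => by
    rw [hψ_def, IccExtend_of_mem _ _ hs]; rfl
  have hint : ∀ s ∈ Icc 0 T, u s = u 0 + ∫ x in (0 : ℝ)..s, ψ x := by
    intro s hs
    have hus : AbsolutelyContinuousOnInterval u 0 s := hu.mono (by
      rw [uIcc_of_le hs.1, uIcc_of_le hT]; exact Icc_subset_Icc_right hs.2)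
    have h1 : ∫ x in (0 : ℝ)..s, ψ x = ∫ x in (0 : ℝ)..s, deriv u x := by
      refine intervalIntegral.integral_congr_ae ?_
      rw [ae_restrict_iff' measurableSet_Ioo] at h
      filter_upwards [h, Measure.ae_ne volume T] with x hx hxT hxs
      rw [uIoc_of_le hs.1] at hxs
      rw [hx ⟨hxs.1, lt_of_le_of_ne (hxs.2.trans hs.2) hxT⟩, hψφ x ⟨hxs.1.le, hxs.2.trans hs.2⟩]
    rw [h1, hus.integral_deriv_eq_sub]
    ring
  have h2 : HasDerivAt (fun s => u 0 + ∫ x in (0 : ℝ)..s, ψ x) (ψ t) t :=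
    (hψ.integral_hasStrictDerivAt 0 t).hasDerivAt.const_add _
  rw [← hψφ t ht]
  exact h2.hasDerivWithinAt.congr hint (hint t ht)

theorem abs_le_linftyNorm {N j : ℕ} (hj : j ∈ Finset.Icc 1 N) (x : ℕ → ℝ) :
    |x j| ≤ linftyNorm N x :=
  le_ciSup (f := fun j : {j : ℕ // j ∈ Finset.Icc 1 N} => |x j|) (Set.finite_range _).bddAbove ⟨j, hj⟩

theorem continuousOn_linftyNorm {N : ℕ} {s : Set ℝ} {x : ℕ → ℝ → ℝ}
    (hx : ∀ j ∈ Finset.Icc 1 N, ContinuousOn (x j) s) :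
    ContinuousOn (fun t => linftyNorm N fun j => x j t) s := by
  unfold linftyNorm
  -- For N = 0 the supremum is over an empty type and equals 0 by convention; otherwise it is a
  -- finite maximum.
  rcases isEmpty_or_nonempty {j : ℕ // j ∈ Finset.Icc 1 N} with he | he
  · simp only [Real.iSup_of_isEmpty]
    exact continuousOn_const
  · simp only [← Finset.sup'_univ_eq_ciSup]
    exact ContinuousOn.finset_sup'_apply _ fun j _ => (hx j j.2).abs

variable {N : ℕ} {T m : ℝ} {p q : ℕ → ℝ} {g : ℕ → ℝ → ℝ} {g0 g1 : ℝ → ℝ} {y0 y1 : ℕ → ℝ}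
  {yp yq : ℕ → ℝ → ℝ}

theorem continuousOn_discreteLaplacian {s : Set ℝ} {x : ℕ → ℝ → ℝ}
    (hx : ∀ j ≤ N + 1, ContinuousOn (x j) s) {j : ℕ} (hj : j ∈ Finset.Icc 1 N) :
    ContinuousOn (fun t => discreteLaplacian N (fun i => x i t) j) s := by
  rw [Finset.mem_Icc] at hj
  exact (((hx _ (by omega)).sub (continuousOn_const.mul (hx _ (by omega)))).add
    (hx _ (by omega))).div_const _

theorem hasDerivWithinAt_discreteLaplacian {s : Set ℝ} {x x' : ℕ → ℝ → ℝ} {t : ℝ}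
    (hx : ∀ j ≤ N + 1, HasDerivWithinAt (x j) (x' j t) s t) {j : ℕ} (hj : j ∈ Finset.Icc 1 N) :
    HasDerivWithinAt (fun t => discreteLaplacian N (fun i => x i t) j)
      (discreteLaplacian N (fun i => x' i t) j) s t := by
  rw [Finset.mem_Icc] at hj
  exact (((hx _ (by omega)).sub ((hx _ (by omega)).const_mul 2)).add
    (hx _ (by omega))).div_const _

/-- The difference of two solutions is `C³` in time, and its first three time derivatives solve the
linearized equation. -/
theorem IsSolution.exists_derivs (hT : 0 < T) (Hp : IsSolution N T p g g0 g1 y0 y1 yp)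
    (Hq : IsSolution N T q g g0 g1 y0 y1 yq) :
    ∃ W V A : ℕ → ℝ → ℝ,
      (∀ j ≤ N + 1, ∀ t ∈ Icc 0 T,
        HasDerivWithinAt (fun s => yq j s - yp j s) (W j t) (Icc 0 T) t ∧
        HasDerivWithinAt (W j) (V j t) (Icc 0 T) t ∧
        HasDerivWithinAt (V j) (A j t) (Icc 0 T) t) ∧
      (∀ t, V 0 t = 0 ∧ V (N + 1) t = 0 ∧ A 0 t = 0 ∧ A (N + 1) t = 0) ∧
      (∀ j ∈ Finset.Icc 1 N, ∀ t, A j t = discreteLaplacian N (fun i => W i t) j - q j * W j t +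
        (p j - q j) * derivWithin (yp j) (Icc 0 T) t) ∧
      (∀ j ≤ N + 1, W j 0 = 0) ∧
      ∀ j ∈ Finset.Icc 1 N, V j 0 = (p j - q j) * y0 j := by
  classical
  have h0 : (0 : ℝ) ∈ Icc 0 T := ⟨le_rfl, hT.le⟩
  set z : ℕ → ℝ → ℝ := fun j t => yq j t - yp j t with hz
  set W : ℕ → ℝ → ℝ := fun j t => if j ∈ Finset.Icc 1 N then
    derivWithin (yq j) (Icc 0 T) t - derivWithin (yp j) (Icc 0 T) t else 0 with hW
  -- The second derivative is defined by the right-hand side of the difference equation, which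
  -- contains no g and is visibly differentiable; that it is the derivative of `W` is proved below.
  set V : ℕ → ℝ → ℝ := fun j t => if j ∈ Finset.Icc 1 N then
    discreteLaplacian N (fun i => z i t) j - q j * z j t + (p j - q j) * yp j t else 0 with hV
  set A : ℕ → ℝ → ℝ := fun j t => if j ∈ Finset.Icc 1 N then
    discreteLaplacian N (fun i => W i t) j - q j * W j t +
      (p j - q j) * derivWithin (yp j) (Icc 0 T) t else 0 with hA
  have n0 : (0 : ℕ) ∉ Finset.Icc 1 N := by simp
  have nN : N + 1 ∉ Finset.Icc 1 N := by simp
  have hcases : ∀ j ≤ N + 1, j ∉ Finset.Icc 1 N → j = 0 ∨ j = N + 1 := by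
    intro j hj hn
    rw [Finset.mem_Icc] at hn
    omega
  have hzb : ∀ j ≤ N + 1, j ∉ Finset.Icc 1 N → ∀ t ∈ Icc 0 T, z j t = 0 := by
    intro j hj hn t ht
    rcases hcases j hj hn with rfl | rfl
    · simp only [hz, Hq.boundary_left t ht, Hp.boundary_left t ht, sub_self]
    · simp only [hz, Hq.boundary_right t ht, Hp.boundary_right t ht, sub_self]
  have dz : ∀ j ≤ N + 1, ∀ t ∈ Icc 0 T, HasDerivWithinAt (z j) (W j t) (Icc 0 T) t := by
    intro j hj t ht
    by_cases hn : j ∈ Finset.Icc 1 N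
    · simp only [hW, if_pos hn]
      exact (Hq.differentiable j hn t ht).hasDerivWithinAt.sub
        (Hp.differentiable j hn t ht).hasDerivWithinAt
    · simp only [hW, if_neg hn]
      exact (hasDerivWithinAt_const t (Icc 0 T) (0 : ℝ)).congr (hzb j hj hn) (hzb j hj hn t ht)
  have cz : ∀ j ≤ N + 1, ContinuousOn (z j) (Icc 0 T) := fun j hj t ht =>
    (dz j hj t ht).continuousWithinAt
  have dW : ∀ j ≤ N + 1, ∀ t ∈ Icc 0 T, HasDerivWithinAt (W j) (V j t) (Icc 0 T) t := by
    intro j hj t ht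
    by_cases hn : j ∈ Finset.Icc 1 N
    · have e1 : W j = derivWithin (yq j) (Icc 0 T) - derivWithin (yp j) (Icc 0 T) := by
        funext s; simp only [hW, if_pos hn, Pi.sub_apply]
      simp only [hV, if_pos hn, e1]
      refine hasDerivWithinAt_of_absolutelyContinuous (φ := fun t =>
        discreteLaplacian N (fun i => z i t) j - q j * z j t + (p j - q j) * yp j t)
        ((Hq.absolutelyContinuous j hn).sub (Hp.absolutelyContinuous j hn))
        (((continuousOn_discreteLaplacian cz hn).sub (continuousOn_const.mul (cz j hj))).add
          (continuousOn_const.mul (Hp.differentiable j hn).continuousOn)) ?_ ht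
      -- Almost everywhere both velocities are differentiable, so the two equations can be
      -- subtracted and g disappears.
      filter_upwards [Hq.equation j hn, Hp.equation j hn,
        ae_restrict_of_ae (Hq.absolutelyContinuous j hn).ae_differentiableAt,
        ae_restrict_of_ae (Hp.absolutelyContinuous j hn).ae_differentiableAt,
        ae_restrict_mem measurableSet_Ioo] with s hs1 hs2 hs3 hs4 hs5
      have hs6 : s ∈ uIcc 0 T := by rw [uIcc_of_le hT.le]; exact Ioo_subset_Icc_self hs5
      rw [deriv_sub (hs3 hs6) (hs4 hs6)]
      have e2 : discreteLaplacian N (fun i => z i s) j = discreteLaplacian N (fun i => yq i s) j -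
          discreteLaplacian N (fun i => yp i s) j := by
        simp only [discreteLaplacian, hz]; ring
      rw [e2]
      simp only [hz]
      linarith
    · have e1 : W j = fun _ => 0 := by funext s; simp only [hW, if_neg hn]
      simp only [hV, if_neg hn, e1]
      exact hasDerivWithinAt_const _ _ _
  have dV : ∀ j ≤ N + 1, ∀ t ∈ Icc 0 T, HasDerivWithinAt (V j) (A j t) (Icc 0 T) t := by
    intro j hj t ht
    by_cases hn : j ∈ Finset.Icc 1 N
    · simp only [hV, hA, if_pos hn]
      exact ((hasDerivWithinAt_discreteLaplacian (fun i hi => dz i hi t ht) hn).sub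
        ((dz j hj t ht).const_mul (q j))).add
          ((Hp.differentiable j hn t ht).hasDerivWithinAt.const_mul (p j - q j))
    · simp only [hV, hA, if_neg hn]
      exact hasDerivWithinAt_const _ _ _
  have z0 : ∀ j ≤ N + 1, z j 0 = 0 := by
    intro j hj
    by_cases hn : j ∈ Finset.Icc 1 N
    · simp only [hz, Hq.initial_position j hn, Hp.initial_position j hn, sub_self]
    · exact hzb j hj hn 0 h0
  refine ⟨W, V, A, fun j hj t ht => ⟨dz j hj t ht, dW j hj t ht, dV j hj t ht⟩,
    fun t => ⟨if_neg n0, if_neg nN, if_neg n0, if_neg nN⟩, fun j hn t => if_pos hn, ?_, ?_⟩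
  · intro j hj
    by_cases hn : j ∈ Finset.Icc 1 N
    · simp only [hW, if_pos hn, Hq.initial_velocity j hn, Hp.initial_velocity j hn, sub_self]
    · simp only [hW, if_neg hn]
  · intro j hn
    have hj := Finset.mem_Icc.1 hn
    simp only [hV, if_pos hn, discreteLaplacian, z0 j (by omega), z0 (j + 1) (by omega),
      z0 (j - 1) (by omega), Hp.initial_position j hn]
    ring

theorem contDiffOn_two_of_hasDerivWithinAt {u u' u'' : ℝ → ℝ} (hT : 0 < T)
    (h1 : ∀ t ∈ Icc 0 T, HasDerivWithinAt u (u' t) (Icc 0 T) t)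
    (h2 : ∀ t ∈ Icc 0 T, HasDerivWithinAt u' (u'' t) (Icc 0 T) t)
    (h3 : ContinuousOn u'' (Icc 0 T)) : ContDiffOn ℝ 2 u (Icc 0 T) := by
  have hs := uniqueDiffOn_Icc hT
  rw [show (2 : WithTop ℕ∞) = 1 + 1 by norm_num, contDiffOn_succ_iff_derivWithin hs]
  refine ⟨fun t ht => (h1 t ht).differentiableWithinAt, by simp, ?_⟩
  have : ContDiffOn ℝ 1 u' (Icc 0 T) := by
    rw [show (1 : WithTop ℕ∞) = 0 + 1 by norm_num, contDiffOn_succ_iff_derivWithin hs]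
    refine ⟨fun t ht => (h2 t ht).differentiableWithinAt, by simp, ?_⟩
    rw [contDiffOn_zero]
    exact h3.congr fun t ht => (h2 t ht).derivWithin (hs t ht)
  exact this.congr fun t ht => (h1 t ht).derivWithin (hs t ht)

theorem iteratedDeriv_two_eq {u u' u'' : ℝ → ℝ}
    (h1 : ∀ t ∈ Icc 0 T, HasDerivWithinAt u (u' t) (Icc 0 T) t)
    (h2 : ∀ t ∈ Icc 0 T, HasDerivWithinAt u' (u'' t) (Icc 0 T) t) {t : ℝ} (ht : t ∈ Ioo 0 T) :
    iteratedDeriv 2 u t = u'' t := by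
  rw [iteratedDeriv_succ, iteratedDeriv_one]
  have h3 : deriv u =ᶠ[𝓝 t] u' := by
    filter_upwards [Ioo_mem_nhds ht.1 ht.2] with s hs
    exact ((h1 s (Ioo_subset_Icc_self hs)).hasDerivAt (Icc_mem_nhds hs.1 hs.2)).deriv
  rw [h3.deriv_eq]
  exact ((h2 t (Ioo_subset_Icc_self ht)).hasDerivAt (Icc_mem_nhds ht.1 ht.2)).deriv

theorem sum_Icc_one_eq_sum_range (N : ℕ) (x : ℕ → ℝ) :
    ∑ j ∈ Finset.Icc 1 N, x j = ∑ j ∈ range N, x (j + 1) := by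
  induction N with
  | zero => simp
  | succ n ih => rw [Finset.sum_Icc_succ_top (by omega), ih, sum_range_succ]

theorem IsSolution.continuousOn_derivWithin (hT : 0 < T)
    (Hp : IsSolution N T p g g0 g1 y0 y1 yp) {j : ℕ} (hj : j ∈ Finset.Icc 1 N) :
    ContinuousOn (derivWithin (yp j) (Icc 0 T)) (Icc 0 T) := by
  have := (Hp.absolutelyContinuous j hj).continuousOn
  rwa [uIcc_of_le hT.le] at this

theorem IsSolution.integral_sq_velocity_le (hT : 0 < T) {K : ℝ} (hK : 0 < K)
    (Hp : IsSolution N T p g g0 g1 y0 y1 yp) (h : h1LinftyNorm N T yp ≤ K) :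
    ∫ t in (0 : ℝ)..T, linftyNorm N (fun j => derivWithin (yp j) (Icc 0 T) t) ^ 2 ≤ K ^ 2 := by
  have h1 : ContinuousOn (fun t => linftyNorm N (fun j => yp j t) ^ 2) (uIcc 0 T) := by
    rw [uIcc_of_le hT.le]
    exact (continuousOn_linftyNorm fun j hj => (Hp.differentiable j hj).continuousOn).pow 2
  have h2 : ContinuousOn (fun t => linftyNorm N (fun j => derivWithin (yp j) (Icc 0 T) t) ^ 2)
      (uIcc 0 T) := by
    rw [uIcc_of_le hT.le]
    exact (continuousOn_linftyNorm fun j hj => Hp.continuousOn_derivWithin hT hj).pow 2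
  rw [h1LinftyNorm, Real.sqrt_le_left hK.le] at h
  have h3 : ∫ t in (0 : ℝ)..T, (linftyNorm N (fun j => yp j t) ^ 2 +
      linftyNorm N (fun j => deriv (yp j) t) ^ 2) =
      ∫ t in (0 : ℝ)..T, (linftyNorm N (fun j => yp j t) ^ 2 +
        linftyNorm N (fun j => derivWithin (yp j) (Icc 0 T) t) ^ 2) := by
    -- Two-sided and one-sided derivatives agree in the open interval, and the endpoints do not
    -- affect the integral.
    refine intervalIntegral.integral_congr_Ioo_of_le hT.le fun t ht => ?_
    simp only [derivWithin_of_mem_nhds (Icc_mem_nhds ht.1 ht.2)]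
  rw [h3, intervalIntegral.integral_add h1.intervalIntegrable h2.intervalIntegrable] at h
  exact (le_add_of_nonneg_left
    (intervalIntegral.integral_nonneg hT.le fun t _ => sq_nonneg _)).trans h

end SemiDiscreteWave

theorem theorem3p1 (T m K r : ℝ) (hT : 1 < T) (hm : 0 < m) (hK : 0 < K) (hr : 0 < r) :
    ∃ C : ℝ, 0 < C ∧
      ∀ (N : ℕ) (g : ℕ → ℝ → ℝ) (g0 g1 : ℝ → ℝ) (y0 y1 : ℕ → ℝ) (p : ℕ → ℝ) (yp : ℕ → ℝ → ℝ),
        (∀ j ∈ Finset.Icc 1 N, IntegrableOn (g j) (Ioo 0 T)) →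
        MemLp g0 2 (volume.restrict (Ioo 0 T)) →
        MemLp g1 2 (volume.restrict (Ioo 0 T)) →
        linftyNorm N p ≤ m →
        IsSolution N T p g g0 g1 y0 y1 yp →
        h1LinftyNorm N T yp ≤ K →
        (∀ j ∈ Finset.Icc 1 N, r ≤ |y0 j|) →
        ∀ (q : ℕ → ℝ) (yq : ℕ → ℝ → ℝ),
          linftyNorm N q ≤ m →
          IsSolution N T q g g0 g1 y0 y1 yq →
          (∀ j ∈ Finset.Icc 0 (N + 1),
            ContDiffOn ℝ 2 (fun t => yq j t - yp j t) (Icc 0 T)) ∧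
          l2Norm N (fun j => q j - p j) ≤
            C * timeL2Norm T (fun t =>
                deriv (fun s => backwardDiff N (fun j => yq j s - yp j s) (N + 1)) t)
            + C * timeL2Norm T (fun t => l2NormLeft N (fun j =>
                meshSize N *
                  forwardDiff N (fun i => iteratedDeriv 2 (fun s => yq i s - yp i s) t) j)) := by
  have hT0 : 0 < T := by linarith
  obtain ⟨C, hC, hmain⟩ := exists_stability_constant T m K r hT hm hr
  -- The mass carries the factor h/2, so the squared norm of q − p is twice the mass; the root comes
  -- from passing from squares to norms.
  refine ⟨Real.sqrt (2 * C), by positivity, ?_⟩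
  intro N g g0 g1 y0 y1 p yp _ _ _ _ Hp hyp hy0 q yq hq Hq
  obtain ⟨W, V, A, hder, hbd, hA, hW0, hV0⟩ := Hp.exists_derivs hT0 Hq
  have hh := meshSize_pos N
  have hI : ∀ j ∈ Finset.range N, j + 1 ∈ Finset.Icc 1 N := fun j hj => by
    have := Finset.mem_range.1 hj
    rw [Finset.mem_Icc]; omega
  have H : IsLinearizedWave N T m q (fun j => p j - q j) y0
      (fun t => linftyNorm N (fun j => derivWithin (yp j) (Icc 0 T) t) ^ 2)
      (fun j t => derivWithin (yp j) (Icc 0 T) t) W V A :=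
    { continuousOn_w := fun j hj t ht => (hder j hj t ht).2.1.continuousWithinAt
      continuousOn_v := fun j hj t ht => (hder j hj t ht).2.2.continuousWithinAt
      hasDerivAt_w := fun j hj t ht => (hder j hj t (Ioo_subset_Icc_self ht)).2.1.hasDerivAt
        (Icc_mem_nhds ht.1 ht.2)
      hasDerivAt_v := fun j hj t ht => (hder j hj t (Ioo_subset_Icc_self ht)).2.2.hasDerivAt
        (Icc_mem_nhds ht.1 ht.2)
      v_left := fun t _ => (hbd t).1
      v_right := fun t _ => (hbd t).2.1
      a_left := fun t _ => (hbd t).2.2.1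
      a_right := fun t _ => (hbd t).2.2.2
      equation := fun t _ j hj => by
        rw [hA _ (hI j hj)]
        simp only [discreteLaplacian, forwardDiff, Nat.add_sub_cancel]
        field_simp
        ring
      abs_q_le := fun j hj => (abs_le_linftyNorm (hI j hj) q).trans hq
      continuousOn_κ :=
        (continuousOn_linftyNorm fun j hj => Hp.continuousOn_derivWithin hT0 hj).pow 2
      κ_nonneg := fun t _ => sq_nonneg _
      sq_Y_le := fun t _ j hj => by
        rw [← sq_abs]
        exact pow_le_pow_left₀ (abs_nonneg _)
          (abs_le_linftyNorm (hI j hj) fun j => derivWithin (yp j) (Icc 0 T) t) 2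
      w_zero := hW0
      v_zero := fun j hj => hV0 _ (hI j hj) }
  have hest := hmain N q _ y0 _ _ W V A H (Hp.integral_sq_velocity_le hT0 hK hyp)
    fun j hj => hy0 _ (hI j hj)
  refine ⟨fun j hj => ?_, ?_⟩
  · have hj' : j ≤ N + 1 := (Finset.mem_Icc.1 hj).2
    exact contDiffOn_two_of_hasDerivWithinAt hT0 (fun t ht => (hder j hj' t ht).1)
      (fun t ht => (hder j hj' t ht).2.1) (H.continuousOn_v j hj')
  have e1 : timeL2Norm T (fun t =>
      deriv (fun s => backwardDiff N (fun j => yq j s - yp j s) (N + 1)) t) =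
      Real.sqrt (∫ t in (0 : ℝ)..T, forwardDiff N (fun i => W i t) N ^ 2) := by
    rw [timeL2Norm, intervalIntegral.integral_congr_Ioo_of_le hT0.le]
    intro t ht
    have hd : ∀ j ≤ N + 1, HasDerivAt (fun s => yq j s - yp j s) (W j t) t := fun j hj =>
      (hder j hj t (Ioo_subset_Icc_self ht)).1.hasDerivAt (Icc_mem_nhds ht.1 ht.2)
    -- The backward difference at N + 1 is the forward difference at N, the slope of the last edge.
    have hd2 : HasDerivAt (fun s => backwardDiff N (fun j => yq j s - yp j s) (N + 1))
        (forwardDiff N (fun i => W i t) N) t :=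
      ((hd (N + 1) le_rfl).sub (hd N (by omega))).div_const _
    simp only [hd2.deriv, sq_abs]
  have e2 : timeL2Norm T (fun t => l2NormLeft N (fun j => meshSize N *
      forwardDiff N (fun i => iteratedDeriv 2 (fun s => yq i s - yp i s) t) j)) =
      Real.sqrt (∫ t in (0 : ℝ)..T,
        weightedJump N (meshSize N) (fun _ => 1) (fun i => V i t)) := by
    rw [timeL2Norm, intervalIntegral.integral_congr_Ioo_of_le hT0.le]
    intro t ht
    have hd : ∀ j ≤ N + 1, iteratedDeriv 2 (fun s => yq j s - yp j s) t = V j t := fun j hj =>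
      iteratedDeriv_two_eq (fun t ht => (hder j hj t ht).1) (fun t ht => (hder j hj t ht).2.1) ht
    simp only [l2NormLeft, sq_abs]
    -- The factor h in front of the forward difference cancels its denominator, leaving exactly the
    -- jumps of ∂ₜₜz.
    rw [Real.sq_sqrt (by positivity), weightedJump, Nat.range_succ_eq_Icc_zero]
    congr 1
    refine Finset.sum_congr rfl fun j hj => ?_
    have hj' := (Finset.mem_Icc.1 hj).2
    rw [forwardDiff, hd j (by omega), hd (j + 1) (by omega), mul_div_cancel₀ _ hh.ne']
    ring
  have e3 : l2Norm N (fun j => q j - p j) =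
      Real.sqrt (2 * weightedMass N (meshSize N) (fun _ => 1) fun j => p j - q j) := by
    rw [l2Norm, sum_Icc_one_eq_sum_range, weightedMass]
    congr 1
    rw [← mul_assoc, mul_div_cancel₀ _ (two_ne_zero' ℝ)]
    congr 1
    refine Finset.sum_congr rfl fun j _ => ?_
    rw [sq_abs]; ring
  rw [e1, e2, e3, ← mul_add]
  set B := ∫ t in (0 : ℝ)..T, forwardDiff N (fun i => W i t) N ^ 2
  set R := ∫ t in (0 : ℝ)..T, weightedJump N (meshSize N) (fun _ => 1) (fun i => V i t)
  have hR0 : 0 ≤ R := intervalIntegral.integral_nonneg hT0.le fun t _ =>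
    weightedJump_nonneg hh.le (fun _ => zero_le_one) _
  have hB0 : 0 ≤ B := intervalIntegral.integral_nonneg hT0.le fun t _ => sq_nonneg _
  have hsqrt : Real.sqrt (B + R) ≤ Real.sqrt B + Real.sqrt R := by
    rw [Real.sqrt_le_left (by positivity)]
    nlinarith [Real.sq_sqrt hB0, Real.sq_sqrt hR0,
      mul_nonneg (Real.sqrt_nonneg B) (Real.sqrt_nonneg R)]
  calc _ ≤ Real.sqrt (2 * C * (B + R)) := Real.sqrt_le_sqrt (by linarith)
    _ = Real.sqrt (2 * C) * Real.sqrt (B + R) := Real.sqrt_mul (by positivity) _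
    _ ≤ Real.sqrt (2 * C) * (Real.sqrt B + Real.sqrt R) :=
      mul_le_mul_of_nonneg_left (hsqrt) (Real.sqrt_nonneg _)
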